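/- For $S\subseteq\mathbb R$ let $L_{1,1}(S)$ be the set of real-valued measurable functions $q$ on $S$ with $\int_S(1+|x|)\,|q(x)|\,dx<\infty$, and write $\mathbb R_+=(0,\infty)$, $\mathbb R_-=(-\infty,0)$. Solutions $u$ of $$u''+k^2u-q(x)u=0\qquad(*)$$ are understood in the usual sense: $u$ is differentiable, $u'$ is locally absolutely continuous, and $(*)$ holds almost everywhere. For $k>0$: * if $q\in L_{1,1}(\mathbb R_+)$, then $f(x,k)$ is the unique solution of $(*)$ on $[0,\infty)$ with $f(x,k)=e^{ikx}+o(1)$ as $x\to+\infty$ (the Jost solution), and $\varphi(x,k)$, $\psi(x,k)$ are the solutions on $[0,\infty)$ with $\varphi(0,k)=0$, $\varphi'(0,k)=1$ and $\psi(0,k)=1$, $\psi'(0,k)=0$; * if $q\in L_{1,1}(\mathbb R_-)$, then $g(x,k)$ is the unique solution of $(*)$ on $(-\infty,0]$ with $g(x,k)=e^{ikx}+o(1)$ as $x\to-\infty$. Below, $f_j,\varphi_j,\psi_j,g_j$ denote these solutions for $q=q_j$, $j=1,2$. **Theorem 1.1.** Let $q_1,q_2\in L_{1,1}(\mathbb R_+)$.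 Then the pair $\{L_1,L_2\}$, $L_j=-\frac{d^2}{dx^2}+q_j(x)$, has the following properties. * ($C_+$) If $p\in L_{1,1}(\mathbb R_+)$ and $\int_0^\infty p(x)f_1(x,k)f_2(x,k)\,dx=0$ for all $k>0$, then $p=0$ almost everywhere on $\mathbb R_+$. * ($C_\varphi$) For every $b\in(0,\infty)$: if $p$ is a real-valued integrable function on $(0,b)$ and $\int_0^b p(x)\varphi_1(x,k)\varphi_2(x,k)\,dx=0$ for all $k>0$, then $p=0$ almost everywhere on $(0,b)$. * ($C_\psi$) For every $b\in(0,\infty)$: if $p$ is a real-valued integrable function on $(0,b)$ and $\int_0^b p(x)\psi_1(x,k)\psi_2(x,k)\,dx=0$ for all $k>0$, then $p=0$ almost everywhere on $(0,b)$. If $q_1,q_2\in L_{1,1}(\mathbb R_-)$, then the pair $\{L_1,L_2\}$ has the following property. * ($C_-$) If $p\in L_{1,1}(\mathbb R_-)$ and $\int_{-\infty}^0 p(x)g_1(x,k)g_2(x,k)\,dx=0$ for all $k>0$, then $p=0$ almost everywhere on $\mathbb R_-$. -/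

import Mathlib

open MeasureTheory Set Filter Topology

/-- The real-valued class `L_{1,m}(S)`: `∫_S (1 + |x|)^m |q(x)| dx < ∞`.  Integrability of the
weighted function includes the measurability of `q` on `S`, since the weight never vanishes. -/
def MemL1m (m : ℕ) (S : Set ℝ) (q : ℝ → ℝ) : Prop :=
  IntegrableOn (fun x => (1 + |x|) ^ m * q x) S

/-- `u` solves `u'' + k² u - q u = 0` on the interval `I` with derivative `u'`, in the usual sense
for locally integrable `q`: `u` is differentiable on `I` with derivative `u'` (one-sided at an
endpoint that belongs to `I`), and `u'` is locally absolutely continuous with `u'' = (q - k²) u`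
almost everywhere, that is, `u'` is an indefinite integral of the locally integrable function
`(q - k²) u`. -/
structure IsSchrodingerSolution (q : ℝ → ℝ) (k : ℝ) (I : Set ℝ) (u u' : ℝ → ℂ) : Prop where
  hasDeriv : ∀ x ∈ I, HasDerivWithinAt u (u' x) I x
  integrable : ∀ x ∈ I, ∀ y ∈ I,
    IntervalIntegrable (fun t => ((q t - k ^ 2 : ℝ) : ℂ) * u t) volume x y
  integral_eq : ∀ x ∈ I, ∀ y ∈ I,
    u' y - u' x = ∫ t in x..y, ((q t - k ^ 2 : ℝ) : ℂ) * u t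

/-- `f` is the Jost solution on `[0, ∞)`: `f(x) = e^{ikx} + o(1)` as `x → +∞`. -/
def IsJostSolution (q : ℝ → ℝ) (k : ℝ) (f : ℝ → ℂ) : Prop :=
  (∃ f' : ℝ → ℂ, IsSchrodingerSolution q k (Ici 0) f f') ∧
    Tendsto (fun x : ℝ => f x - Complex.exp (Complex.I * k * x)) atTop (𝓝 0)

/-- `g` is the solution `g_+` on `(-∞, 0]`: `g(x) = e^{ikx} + o(1)` as `x → -∞`. -/
def IsLeftJostSolution (q : ℝ → ℝ) (k : ℝ) (g : ℝ → ℂ) : Prop :=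
  (∃ g' : ℝ → ℂ, IsSchrodingerSolution q k (Iic 0) g g') ∧
    Tendsto (fun x : ℝ => g x - Complex.exp (Complex.I * k * x)) atBot (𝓝 0)

/-- `φ` is the solution on `[0, ∞)` with `φ(0) = 0`, `φ'(0) = 1`. -/
def IsPhiSolution (q : ℝ → ℝ) (k : ℝ) (φ : ℝ → ℂ) : Prop :=
  ∃ φ' : ℝ → ℂ, IsSchrodingerSolution q k (Ici 0) φ φ' ∧ φ 0 = 0 ∧ φ' 0 = 1

/-- `ψ` is the solution on `[0, ∞)` with `ψ(0) = 1`, `ψ'(0) = 0`. -/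
def IsPsiSolution (q : ℝ → ℝ) (k : ℝ) (ψ : ℝ → ℂ) : Prop :=
  ∃ ψ' : ℝ → ℂ, IsSchrodingerSolution q k (Ici 0) ψ ψ' ∧ ψ 0 = 1 ∧ ψ' 0 = 0

/-- Property `C_+` of the pair `L_j = -d²/dx² + q_j`.  For each `k > 0` the Jost solutions are
unique; the orthogonality condition is imposed on them by "for all `f₁, f₂` that are Jost
solutions", so that it would be void, and the property stronger, if they failed to exist. -/
def PropertyCPlus (q₁ q₂ : ℝ → ℝ) : Prop :=
  ∀ p : ℝ → ℝ, MemL1m 1 (Ioi 0) p →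
    (∀ k : ℝ, 0 < k → ∀ f₁ f₂ : ℝ → ℂ, IsJostSolution q₁ k f₁ → IsJostSolution q₂ k f₂ →
      ∫ x in Ioi (0 : ℝ), (p x : ℂ) * f₁ x * f₂ x = 0) →
    ∀ᵐ x ∂(volume.restrict (Ioi (0 : ℝ))), p x = 0

/-- Property `C_-` of the pair `L_j = -d²/dx² + q_j`. -/
def PropertyCMinus (q₁ q₂ : ℝ → ℝ) : Prop :=
  ∀ p : ℝ → ℝ, MemL1m 1 (Iio 0) p →
    (∀ k : ℝ, 0 < k → ∀ g₁ g₂ : ℝ → ℂ, IsLeftJostSolution q₁ k g₁ → IsLeftJostSolution q₂ k g₂ →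
      ∫ x in Iio (0 : ℝ), (p x : ℂ) * g₁ x * g₂ x = 0) →
    ∀ᵐ x ∂(volume.restrict (Iio (0 : ℝ))), p x = 0

/-- Property `C_φ` of the pair `L_j = -d²/dx² + q_j`, on every finite interval `(0, b)`. -/
def PropertyCPhi (q₁ q₂ : ℝ → ℝ) : Prop :=
  ∀ b : ℝ, 0 < b → ∀ p : ℝ → ℝ, IntegrableOn p (Ioo 0 b) →
    (∀ k : ℝ, 0 < k → ∀ φ₁ φ₂ : ℝ → ℂ, IsPhiSolution q₁ k φ₁ → IsPhiSolution q₂ k φ₂ →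
      ∫ x in Ioo (0 : ℝ) b, (p x : ℂ) * φ₁ x * φ₂ x = 0) →
    ∀ᵐ x ∂(volume.restrict (Ioo (0 : ℝ) b)), p x = 0

/-- Property `C_ψ` of the pair `L_j = -d²/dx² + q_j`, on every finite interval `(0, b)`. -/
def PropertyCPsi (q₁ q₂ : ℝ → ℝ) : Prop :=
  ∀ b : ℝ, 0 < b → ∀ p : ℝ → ℝ, IntegrableOn p (Ioo 0 b) →
    (∀ k : ℝ, 0 < k → ∀ ψ₁ ψ₂ : ℝ → ℂ, IsPsiSolution q₁ k ψ₁ → IsPsiSolution q₂ k ψ₂ →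
      ∫ x in Ioo (0 : ℝ) b, (p x : ℂ) * ψ₁ x * ψ₂ x = 0) →
    ∀ᵐ x ∂(volume.restrict (Ioo (0 : ℝ) b)), p x = 0

/-!
The proof rests on transformation kernels.  For a potential `q` on the line with `q` and `t⁺ q`
integrable, the Jost solution is `f(x, k) = e^{ikx} ∫ B(x, s) e^{2iks} (δ₀ + ds)` with a real kernel
`B` that does not depend on `k`, equals `1` at `s = 0`, and is bounded and integrable for `s > 0`,
uniformly on half lines `x ≥ a`.  The kernel is the sum of a Neumann series
(`jostIter`, `jostKernel`).  Its convergence comes from a weight `M` for which the Volterra operator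
with kernel `(t - x) |q(t)|` is a contraction by `1/2` (`exists_volterra_weight`).  Under the
Fourier transform in `s` the series becomes the Volterra equation of `f`
(`IsJostMajorant.jostFun_volterra`), and a solution of that equation is a solution of the
Schrödinger equation (`isSchrodingerSolution_of_volterra`).

Solutions with Cauchy data at `0` come from the same construction: the potential `t ↦ q(b - t)`,
extended by zero to `t ≥ b`, has a Jost solution on the whole line that is an exponential beyond
`b`, and the reflection `x ↦ b - x` turns it into the solution with value `1` and derivative `ik`
at `0`.  For `x ∈ (0, b)` its kernel lives on `s ≤ x`.  The solutions `φ` and `ψ` are combinations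
of this wave at the frequencies `k` and `-k`.  Orthogonality is assumed for every admissible pair of
solutions, so existence is all that is needed of them.

An orthogonality relation thus says that the Fourier transform of the image of the density
`p(x) B₁(x, s) B₂(x, r)` under a phase, `x + s + r` for Jost solutions, vanishes.  By uniqueness of
Fourier transforms of measures the density may then be paired with any bounded measurable function
of the phase (`sum_integral_comp_eq_zero_of_fourier`).  The test function `sgn p(z) e^{-Lz}`
isolates the atoms `s = r = 0`, which give `∫ |p| e^{-Lx}`, and for large `L` all other
contributions are at most half of that; hence `p = 0`.  For `φ` and `ψ` the phases are
`± (x - s - r)` and `± (s - r)`, and the test function is the even function `sgn p(|z|) e^{L|z|}` on `0 < |z| < b`.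
-/

/-! ### Uniqueness for Fourier transforms of real measures -/

/-- Integration against the image under `Z` of the positive part `w⁺ μ`. -/
theorem integral_map_withDensity_ofReal {Ω E : Type*} [MeasurableSpace Ω] [NormedAddCommGroup E]
    [NormedSpace ℝ E] {μ : Measure Ω} {w : Ω → ℝ} (hw : Integrable w μ)
    {Z : Ω → ℝ} (hZ : Measurable Z) {g : ℝ → E} (hg : StronglyMeasurable g) :
    ∫ z, g z ∂((μ.withDensity fun a => ENNReal.ofReal (w a)).map Z) =
      ∫ a, (max (w a) 0) • g (Z a) ∂μ := by
  rw [integral_map hZ.aemeasurable hg.aestronglyMeasurable,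
    integral_withDensity_eq_integral_toReal_smul₀ hw.aemeasurable.ennreal_ofReal
      (Eventually.of_forall fun _ => ENNReal.ofReal_lt_top)]
  simp only [ENNReal.toReal_ofReal']

theorem integrable_smul_comp_of_bounded {Ω E : Type*} [MeasurableSpace Ω] [NormedAddCommGroup E]
    [NormedSpace ℝ E] {μ : Measure Ω} {w : Ω → ℝ} (hw : Integrable w μ)
    {Z : Ω → ℝ} (hZ : Measurable Z) {g : ℝ → E} (hg : StronglyMeasurable g)
    {C : ℝ} (hC : ∀ z, ‖g z‖ ≤ C) : Integrable (fun a => w a • g (Z a)) μ :=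
  hw.smul_bdd C (hg.comp_measurable hZ).aestronglyMeasurable
    (Eventually.of_forall fun a => hC (Z a))

/-- Uniqueness for Fourier transforms of real finite measures that are given as finite sums of
images of densities.  Positive frequencies suffice, because the measure is real. -/
theorem sum_integral_comp_eq_zero_of_fourier {Ω ι : Type*} [MeasurableSpace Ω] [Fintype ι]
    {μ : Measure Ω} {w : ι → Ω → ℝ} (hw : ∀ i, Integrable (w i) μ)
    {Z : ι → Ω → ℝ} (hZ : ∀ i, Measurable (Z i))
    (h : ∀ k : ℝ, 0 < k → ∑ i, ∫ a, (w i a : ℂ) * Complex.exp (k * Z i a * Complex.I) ∂μ = 0)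
    {η : ℝ → ℝ} (hη : Measurable η) {C : ℝ} (hC : ∀ z, |η z| ≤ C) :
    ∑ i, ∫ a, w i a * η (Z i a) ∂μ = 0 := by
  classical
  -- the positive part of the image measure for the densities `v`
  let P : (ι → Ω → ℝ) → Measure ℝ := fun v =>
    ∑ i, (μ.withDensity fun a => ENNReal.ofReal (v i a)).map (Z i)
  have hfin : ∀ v : ι → Ω → ℝ, (∀ i, Integrable (v i) μ) → ∀ i,
      IsFiniteMeasure ((μ.withDensity fun a => ENNReal.ofReal (v i a)).map (Z i)) := by
    intro v hv i
    have := isFiniteMeasure_withDensity_ofReal (hv i).2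
    infer_instance
  have hPfin : ∀ v : ι → Ω → ℝ, (∀ i, Integrable (v i) μ) → IsFiniteMeasure (P v) := by
    intro v hv
    have := hfin v hv
    infer_instance
  have hPint : ∀ {E : Type} [NormedAddCommGroup E] [NormedSpace ℝ E] (v : ι → Ω → ℝ),
      (∀ i, Integrable (v i) μ) → ∀ (g : ℝ → E) (D : ℝ), StronglyMeasurable g →
      (∀ z, ‖g z‖ ≤ D) → ∫ z, g z ∂(P v) = ∑ i, ∫ a, (max (v i a) 0) • g (Z i a) ∂μ := by
    intro E _ _ v hv g D hg hD
    have := hfin v hv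
    rw [integral_finsetSum_measure]
    · exact Finset.sum_congr rfl fun i _ => integral_map_withDensity_ofReal (hv i) (hZ i) hg
    · intro i _
      exact Integrable.of_bound hg.aestronglyMeasurable D (Eventually.of_forall hD)
  have hwn : ∀ i, Integrable ((fun i a => -w i a : ι → Ω → ℝ) i) μ := fun i => (hw i).neg
  have hdiff : ∀ {E : Type} [NormedAddCommGroup E] [NormedSpace ℝ E] (g : ℝ → E) (D : ℝ),
      StronglyMeasurable g → (∀ z, ‖g z‖ ≤ D) →
      ∑ i, ∫ a, w i a • g (Z i a) ∂μ
        = ∫ z, g z ∂(P w) - ∫ z, g z ∂(P fun i a => -w i a) := by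
    intro E _ _ g D hg hD
    rw [hPint w hw g D hg hD, hPint _ hwn g D hg hD, ← Finset.sum_sub_distrib]
    refine Finset.sum_congr rfl fun i _ => ?_
    rw [← integral_sub (integrable_smul_comp_of_bounded (hw i).pos_part (hZ i) hg hD)
      (integrable_smul_comp_of_bounded (hwn i).pos_part (hZ i) hg hD)]
    refine integral_congr_ae (Eventually.of_forall fun a => ?_)
    simp only [← sub_smul]
    congr 1
    rcases le_total (w i a) 0 with h0 | h0 <;> simp [h0]
  have := hPfin w hw
  have := hPfin _ hwn
  have hchar : ∀ k : ℝ, 0 < k → charFun (P w) k = charFun (P fun i a => -w i a) k := by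
    intro k hk
    have hd := hdiff (fun z : ℝ => Complex.exp (k * z * Complex.I)) 1
      (by apply Continuous.stronglyMeasurable; fun_prop)
      (fun z => by rw [← Complex.ofReal_mul, Complex.norm_exp_ofReal_mul_I])
    rw [charFun_apply_real, charFun_apply_real, ← sub_eq_zero, ← hd, ← h k hk]
    simp only [Complex.real_smul]
  have heq : P w = P fun i a => -w i a := by
    apply Measure.ext_of_charFun
    have hdense : Dense ({0}ᶜ : Set ℝ) := dense_compl_singleton 0
    refine Continuous.ext_on hdense continuous_charFun continuous_charFun ?_
    intro k hk
    rcases lt_or_gt_of_ne (show k ≠ 0 from hk) with h0 | h0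
    · have := hchar (-k) (by linarith)
      rw [charFun_neg, charFun_neg] at this
      exact (starRingEnd ℂ).injective this
    · exact hchar k h0
  have hd := hdiff η C hη.stronglyMeasurable hC
  rw [heq, sub_self] at hd
  simpa only [smul_eq_mul] using hd

/-- If the pairing `∫ p J` vanishes, where `J` is within a relative error `1/2` of the test function
`sgn p · e`, then `p = 0`. -/
theorem ae_eq_zero_of_integral_mul_eq_zero {α : Type*} [MeasurableSpace α] {μ : Measure α}
    {p σ J e : α → ℝ} (hp : Integrable p μ) (hσ : ∀ x, p x * σ x = |p x|)
    (hσ1 : ∀ x, |σ x| ≤ 1) (hJm : AEStronglyMeasurable J μ)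
    (he : Measurable e) (hpos : ∀ x, 0 < e x) {D : ℝ} (hD : ∀ᵐ x ∂μ, e x ≤ D)
    (hJ : ∀ᵐ x ∂μ, |J x - σ x * e x| ≤ e x / 2) (h : ∫ x, p x * J x ∂μ = 0) :
    p =ᵐ[μ] 0 := by
  have hI : Integrable (fun x => |p x| * e x) μ :=
    hp.abs.mul_bdd (c := D) he.aestronglyMeasurable (by
      filter_upwards [hD] with x hx
      rwa [Real.norm_eq_abs, abs_of_pos (hpos x)])
  have hI2 : Integrable (fun x => p x * J x) μ :=
    hp.mul_bdd (c := 2 * D) hJm (by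
      filter_upwards [hD, hJ] with x hx hx'
      have h1 : |σ x * e x| ≤ e x := by
        rw [abs_mul, abs_of_pos (hpos x)]
        exact mul_le_of_le_one_left (hpos x).le (hσ1 x)
      have h2 := abs_le.1 h1
      have h3 := abs_le.1 hx'
      have := hpos x
      rw [Real.norm_eq_abs, abs_le]
      constructor <;> linarith [h2.1, h2.2, h3.1, h3.2])
  have hle : ∫ x, |p x| * e x ∂μ ≤ ∫ x, (|p x| * e x / 2 + p x * J x) ∂μ := by
    refine integral_mono_ae hI ((hI.div_const 2).add hI2) ?_
    filter_upwards [hJ] with x hx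
    have h3 := mul_le_mul_of_nonneg_left hx (abs_nonneg (p x))
    rw [← abs_mul, mul_sub, ← mul_assoc, hσ] at h3
    have := (abs_le.1 h3).1
    linarith
  rw [integral_add (hI.div_const 2) hI2, h, integral_div] at hle
  have h0 : ∫ x, |p x| * e x ∂μ = 0 := by
    have : 0 ≤ ∫ x, |p x| * e x ∂μ :=
      integral_nonneg fun x => mul_nonneg (abs_nonneg _) (hpos x).le
    linarith
  rw [integral_eq_zero_iff_of_nonneg (fun x => mul_nonneg (abs_nonneg _) (hpos x).le) hI] at h0
  filter_upwards [h0] with x hx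
  have := (hpos x).ne'
  simpa [this] using hx

/-! ### The Volterra operator for transformation kernels -/

/-- The reference measure `δ₀ + ds` on `[0, ∞)`.  The atom carries the leading term `e^{ikx}` of a
Jost solution, so that the solution is a single integral against its kernel. -/
noncomputable def jostMeasure : Measure ℝ := Measure.dirac 0 + volume.restrict (Ioi 0)

instance : SigmaFinite jostMeasure := by unfold jostMeasure; infer_instance

theorem lintegral_jostMeasure {f : ℝ → ENNReal} :
    ∫⁻ s, f s ∂jostMeasure = f 0 + ∫⁻ s in Ioi 0, f s := by
  rw [jostMeasure, lintegral_add_measure, lintegral_dirac]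

theorem integrable_jostMeasure_iff {E : Type*} [NormedAddCommGroup E] {f : ℝ → E} :
    Integrable f jostMeasure ↔ IntegrableOn f (Ioi 0) := by
  rw [jostMeasure, integrable_add_measure]
  exact ⟨fun h => h.2, fun h => ⟨integrable_dirac (by simp), h⟩⟩

theorem integral_jostMeasure {E : Type*} [NormedAddCommGroup E] [NormedSpace ℝ E]
    [CompleteSpace E] {f : ℝ → E} (hf : Integrable f jostMeasure) :
    ∫ s, f s ∂jostMeasure = f 0 + ∫ s in Ioi 0, f s := by
  have h := hf
  rw [jostMeasure, integrable_add_measure] at h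
  rw [jostMeasure, integral_add_measure h.1 h.2, integral_dirac]

theorem ae_jostMeasure_nonneg : ∀ᵐ s ∂jostMeasure, 0 ≤ s := by
  rw [jostMeasure, ae_add_measure_iff]
  refine ⟨by simp [ae_dirac_eq], ?_⟩
  filter_upwards [ae_restrict_mem measurableSet_Ioi] with s hs using le_of_lt hs

/-- The region of `(t, r)` over which the Volterra operator for kernels integrates in order to give
its value at `(x, s)`: `t > x` and `s - (t - x) ≤ r < s`. -/
def jostRegion (y z : ℝ × ℝ) : Prop :=
  0 < y.2 ∧ y.1 < z.1 ∧ z.2 < y.2 ∧ y.2 ≤ z.2 + (z.1 - y.1)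

open Classical in
/-- The integrand of the Volterra operator for kernels. -/
noncomputable def jostIntegrand (q : ℝ → ℝ) (B : ℝ × ℝ → ℝ) (y z : ℝ × ℝ) : ℝ :=
  if jostRegion y z then q z.1 * B z else 0

/-- The Volterra operator `B ↦ ∫_{t > x} ∫ q(t) 1_{r < s ≤ r + t - x} B(t, r)`: under the Laplace
transform `s ↦ 2ik` it becomes `h ↦ ∫_{t > x} (e^{2ik(t - x)} - 1) / (2ik) q(t) h(t) dt`. -/
noncomputable def jostStep (q : ℝ → ℝ) (B : ℝ × ℝ → ℝ) (y : ℝ × ℝ) : ℝ :=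
  ∫ z, jostIntegrand q B y z ∂(volume.prod jostMeasure)

/-- The terms of the Neumann series of the kernel; the first is the indicator of `s = 0`. -/
noncomputable def jostIter (q : ℝ → ℝ) : ℕ → ℝ × ℝ → ℝ
  | 0 => fun y => if y.2 = 0 then 1 else 0
  | n + 1 => jostStep q (jostIter q n)

/-- The kernel `B` of the Jost solution `e^{ikx} ∫ B(x, s) e^{2iks} (δ₀ + ds)`. -/
noncomputable def jostKernel (q : ℝ → ℝ) (y : ℝ × ℝ) : ℝ := ∑' n, jostIter q n y

theorem measurableSet_jostRegion : MeasurableSet {w : (ℝ × ℝ) × ℝ × ℝ | jostRegion w.1 w.2} := by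
  simp only [jostRegion, measurableSet_setOfPred]
  fun_prop

theorem measurable_jostIntegrand {q : ℝ → ℝ} {B : ℝ × ℝ → ℝ} (hq : Measurable q)
    (hB : Measurable B) : Measurable (fun w : (ℝ × ℝ) × ℝ × ℝ => jostIntegrand q B w.1 w.2) := by
  unfold jostIntegrand
  exact Measurable.ite measurableSet_jostRegion (by fun_prop) measurable_const

theorem measurable_jostStep {q : ℝ → ℝ} {B : ℝ × ℝ → ℝ} (hq : Measurable q)
    (hB : Measurable B) : Measurable (jostStep q B) :=
  (StronglyMeasurable.integral_prod_right (ν := volume.prod jostMeasure)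
    (f := jostIntegrand q B) (measurable_jostIntegrand hq hB).stronglyMeasurable).measurable

theorem measurable_jostIter {q : ℝ → ℝ} (hq : Measurable q) (n : ℕ) :
    Measurable (jostIter q n) := by
  induction n with
  | zero =>
    exact Measurable.ite (measurable_snd (measurableSet_singleton (0 : ℝ)))
      measurable_const measurable_const
  | succ n ih => exact measurable_jostStep hq ih

theorem measurable_jostKernel {q : ℝ → ℝ} (hq : Measurable q) : Measurable (jostKernel q) :=
  Measurable.tsum fun n => measurable_jostIter hq n

theorem jostStep_of_nonpos {q : ℝ → ℝ} {B : ℝ × ℝ → ℝ} {y : ℝ × ℝ} (hy : y.2 ≤ 0) :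
    jostStep q B y = 0 := by
  simp [jostStep, jostIntegrand, jostRegion, not_lt.2 hy]

theorem lintegral_enorm_jostIntegrand_le {q : ℝ → ℝ} {B : ℝ × ℝ → ℝ} (z : ℝ × ℝ) (x : ℝ) :
    ∫⁻ s, ‖jostIntegrand q B (x, s) z‖ₑ ∂jostMeasure ≤
      ENNReal.ofReal (z.1 - x) * (‖q z.1‖ₑ * ‖B z‖ₑ) := by
  rw [lintegral_jostMeasure]
  have h0 : jostIntegrand q B (x, 0) z = 0 := by simp [jostIntegrand, jostRegion]
  rw [h0, enorm_zero, zero_add]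
  calc ∫⁻ s in Ioi 0, ‖jostIntegrand q B (x, s) z‖ₑ
      ≤ ∫⁻ s, (Ioc z.2 (z.2 + (z.1 - x))).indicator (fun _ => ‖q z.1‖ₑ * ‖B z‖ₑ) s := by
        refine (lintegral_mono fun s => ?_).trans (setLIntegral_le_lintegral _ _)
        unfold jostIntegrand
        split_ifs with h
        · rw [indicator_of_mem (show s ∈ Ioc z.2 (z.2 + (z.1 - x)) from ⟨h.2.2.1, h.2.2.2⟩),
            enorm_mul]
        · simp
    _ = ENNReal.ofReal (z.1 - x) * (‖q z.1‖ₑ * ‖B z‖ₑ) := by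
        rw [lintegral_indicator_const measurableSet_Ioc, Real.volume_Ioc, mul_comm]
        congr 2
        ring

theorem lintegral_enorm_jostIntegrand_le_setLIntegral {q : ℝ → ℝ} {B : ℝ × ℝ → ℝ}
    (hq : Measurable q) (hB : Measurable B) (x : ℝ) :
    ∫⁻ z, ∫⁻ s, ‖jostIntegrand q B (x, s) z‖ₑ ∂jostMeasure ∂(volume.prod jostMeasure) ≤
      ∫⁻ t in Ioi x, ENNReal.ofReal (t - x) * ‖q t‖ₑ * ∫⁻ r, ‖B (t, r)‖ₑ ∂jostMeasure := by
  calc _ ≤ ∫⁻ z : ℝ × ℝ, ENNReal.ofReal (z.1 - x) * (‖q z.1‖ₑ * ‖B z‖ₑ)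
        ∂(volume.prod jostMeasure) :=
        lintegral_mono fun z => lintegral_enorm_jostIntegrand_le z x
    _ = ∫⁻ t, ENNReal.ofReal (t - x) * ‖q t‖ₑ * ∫⁻ r, ‖B (t, r)‖ₑ ∂jostMeasure := by
        rw [lintegral_prod _ (by fun_prop)]
        refine lintegral_congr fun t => ?_
        rw [← lintegral_const_mul _ (by fun_prop)]
        simp only [mul_assoc]
    _ = _ := by
        rw [← lintegral_indicator measurableSet_Ioi]
        refine lintegral_congr fun t => ?_
        by_cases ht : x < t
        · rw [indicator_of_mem (show t ∈ Ioi x from ht)]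
        · rw [indicator_of_notMem (show t ∉ Ioi x from ht),
            ENNReal.ofReal_of_nonpos (by linarith), zero_mul, zero_mul]

theorem lintegral_enorm_jostStep_le {q : ℝ → ℝ} {B : ℝ × ℝ → ℝ}
    (hq : Measurable q) (hB : Measurable B) (x : ℝ) :
    ∫⁻ s, ‖jostStep q B (x, s)‖ₑ ∂jostMeasure ≤
      ∫⁻ t in Ioi x, ENNReal.ofReal (t - x) * ‖q t‖ₑ * ∫⁻ r, ‖B (t, r)‖ₑ ∂jostMeasure := by
  refine le_trans ?_ (lintegral_enorm_jostIntegrand_le_setLIntegral hq hB x)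
  rw [lintegral_lintegral_swap]
  · exact lintegral_mono fun s => enorm_integral_le_lintegral_enorm _
  · exact ((measurable_jostIntegrand hq hB).comp
      (f := fun w : (ℝ × ℝ) × ℝ => ((x, w.2), w.1)) (by fun_prop)).enorm.aemeasurable

theorem enorm_jostStep_le {q : ℝ → ℝ} {B : ℝ × ℝ → ℝ}
    (hq : Measurable q) (hB : Measurable B) (y : ℝ × ℝ) :
    ‖jostStep q B y‖ₑ ≤ ∫⁻ t in Ioi y.1, ‖q t‖ₑ * ∫⁻ r, ‖B (t, r)‖ₑ ∂jostMeasure := by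
  calc ‖jostStep q B y‖ₑ ≤ ∫⁻ z, ‖jostIntegrand q B y z‖ₑ ∂(volume.prod jostMeasure) :=
        enorm_integral_le_lintegral_enorm _
    _ ≤ ∫⁻ z : ℝ × ℝ, (Ioi y.1).indicator (fun t => ‖q t‖ₑ) z.1 * ‖B z‖ₑ
          ∂(volume.prod jostMeasure) := by
        refine lintegral_mono fun z => ?_
        unfold jostIntegrand
        split_ifs with h
        · rw [indicator_of_mem (show z.1 ∈ Ioi y.1 from h.2.1), enorm_mul]
        · simp
    _ = ∫⁻ t, (Ioi y.1).indicator (fun t => ‖q t‖ₑ) t * ∫⁻ r, ‖B (t, r)‖ₑ ∂jostMeasure := by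
        have : Measurable ((Ioi y.1).indicator (fun t => ‖q t‖ₑ)) :=
          hq.enorm.indicator measurableSet_Ioi
        rw [lintegral_prod _ (by fun_prop)]
        refine lintegral_congr fun t => ?_
        rw [← lintegral_const_mul _ (by fun_prop)]
    _ = _ := by
        rw [← lintegral_indicator measurableSet_Ioi]
        refine lintegral_congr fun t => ?_
        by_cases ht : t ∈ Ioi y.1 <;> simp [ht]

/-- The Laplace transform of `1_{[0, r]}` at the frequency `2k`. -/
noncomputable def jostPhase (k r : ℝ) : ℂ :=
  (Complex.exp (2 * k * r * Complex.I) - 1) / (2 * k * Complex.I)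

/-- The Volterra operator for kernels, seen through the Fourier transform. -/
theorem integral_jostStep_mul_exp {q : ℝ → ℝ} {B : ℝ × ℝ → ℝ}
    (hq : Measurable q) (hB : Measurable B) {x : ℝ}
    (hfin : ∫⁻ t in Ioi x, ENNReal.ofReal (t - x) * ‖q t‖ₑ * ∫⁻ r, ‖B (t, r)‖ₑ ∂jostMeasure < ⊤)
    {k : ℝ} (hk : k ≠ 0) :
    ∫ s, (jostStep q B (x, s) : ℂ) * Complex.exp (2 * k * s * Complex.I) ∂jostMeasure =
      ∫ t in Ioi x, jostPhase k (t - x) * q t *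
        ∫ r, (B (t, r) : ℂ) * Complex.exp (2 * k * r * Complex.I) ∂jostMeasure := by
  have hnorm : ∀ s : ℝ, ‖Complex.exp (2 * k * s * Complex.I)‖ₑ = 1 := by
    intro s
    rw [← ofReal_norm, show (2 * k * s : ℂ) = ((2 * k * s : ℝ) : ℂ) by push_cast; ring,
      Complex.norm_exp_ofReal_mul_I]
    simp
  have hmeas : Measurable fun w : (ℝ × ℝ) × ℝ =>
      (jostIntegrand q B (x, w.2) w.1 : ℂ) * Complex.exp (2 * k * w.2 * Complex.I) :=
    (Complex.measurable_ofReal.comp ((measurable_jostIntegrand hq hB).comp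
      (f := fun w : (ℝ × ℝ) × ℝ => ((x, w.2), w.1)) (by fun_prop))).mul
      (by fun_prop)
  have hint : Integrable (fun w : (ℝ × ℝ) × ℝ =>
      (jostIntegrand q B (x, w.2) w.1 : ℂ) * Complex.exp (2 * k * w.2 * Complex.I))
      ((volume.prod jostMeasure).prod jostMeasure) := by
    refine ⟨hmeas.aestronglyMeasurable, ?_⟩
    rw [HasFiniteIntegral, lintegral_prod _ hmeas.enorm.aemeasurable]
    simp only [enorm_mul, hnorm, mul_one]
    refine lt_of_le_of_lt (lintegral_mono fun z => lintegral_mono fun s => ?_)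
      ((lintegral_enorm_jostIntegrand_le_setLIntegral hq hB x).trans_lt hfin)
    rw [← ofReal_norm, ← ofReal_norm, Complex.norm_real]
  have hswap := integral_integral_swap (f := fun (z : ℝ × ℝ) (s : ℝ) =>
    (jostIntegrand q B (x, s) z : ℂ) * Complex.exp (2 * k * s * Complex.I)) hint
  -- the inner integral in `s`, valid for `r ≥ 0`
  have hinner : ∀ z : ℝ × ℝ, 0 ≤ z.2 →
      ∫ s, (jostIntegrand q B (x, s) z : ℂ) * Complex.exp (2 * k * s * Complex.I) ∂jostMeasure =
        (Ioi x).indicator (fun t => jostPhase k (t - x) * q t) z.1 *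
          ((B z : ℂ) * Complex.exp (2 * k * z.2 * Complex.I)) := by
    intro z hz
    by_cases hx : x < z.1
    · have hEq : ∀ s, (jostIntegrand q B (x, s) z : ℂ) * Complex.exp (2 * k * s * Complex.I) =
          (Ioc z.2 (z.2 + (z.1 - x))).indicator
            (fun s => (q z.1 * B z : ℂ) * Complex.exp (2 * k * s * Complex.I)) s := by
        intro s
        unfold jostIntegrand
        split_ifs with h
        · rw [indicator_of_mem (show s ∈ Ioc z.2 (z.2 + (z.1 - x)) from ⟨h.2.2.1, h.2.2.2⟩)]
          push_cast; rfl
        · rw [indicator_of_notMem]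
          · simp
          · intro hs
            exact h ⟨hz.trans_lt hs.1, hx, hs.1, hs.2⟩
      simp only [hEq]
      have hio : IntegrableOn (fun s : ℝ => (q z.1 * B z : ℂ) * Complex.exp (2 * k * s * Complex.I))
          (Ioc z.2 (z.2 + (z.1 - x))) :=
        (Continuous.integrableOn_Icc (by fun_prop)).mono_set Ioc_subset_Icc_self
      rw [integral_jostMeasure (integrable_jostMeasure_iff.2
          (hio.integrable_indicator measurableSet_Ioc).integrableOn),
        indicator_of_notMem (show (0 : ℝ) ∉ Ioc z.2 (z.2 + (z.1 - x)) from fun h => h.1.not_ge hz),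
        zero_add, setIntegral_indicator measurableSet_Ioc,
        inter_eq_self_of_subset_right
          (show Ioc z.2 (z.2 + (z.1 - x)) ⊆ Ioi 0 from fun s hs => hz.trans_lt hs.1),
        ← intervalIntegral.integral_of_le (by linarith), intervalIntegral.integral_const_mul,
        indicator_of_mem (show z.1 ∈ Ioi x from hx)]
      have hc : (2 * k * Complex.I : ℂ) ≠ 0 := by
        simp [hk]
      have := integral_exp_mul_complex (a := z.2) (b := z.2 + (z.1 - x)) hc
      rw [show (fun s : ℝ => Complex.exp (2 * k * s * Complex.I)) =
        fun s : ℝ => Complex.exp (2 * k * Complex.I * s) by ext s; congr 1; ring, this, jostPhase,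
        show (2 * k * Complex.I * ((z.2 + (z.1 - x) : ℝ) : ℂ)) =
          2 * k * z.2 * Complex.I + 2 * k * ((z.1 - x : ℝ) : ℂ) * Complex.I by push_cast; ring,
        Complex.exp_add,
        show (2 * k * Complex.I * (z.2 : ℂ)) = 2 * k * z.2 * Complex.I by ring]
      ring
    · have : ∀ s, jostIntegrand q B (x, s) z = 0 := by
        intro s
        simp [jostIntegrand, jostRegion, hx]
      rw [indicator_of_notMem (show z.1 ∉ Ioi x from hx)]
      simp [this]
  calc _ = ∫ s, ∫ z, (jostIntegrand q B (x, s) z : ℂ) * Complex.exp (2 * k * s * Complex.I)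
        ∂(volume.prod jostMeasure) ∂jostMeasure := by
        refine integral_congr_ae (Eventually.of_forall fun s => ?_)
        simp only [jostStep]
        rw [integral_mul_const, integral_complex_ofReal]
    _ = ∫ z, ∫ s, (jostIntegrand q B (x, s) z : ℂ) * Complex.exp (2 * k * s * Complex.I)
        ∂jostMeasure ∂(volume.prod jostMeasure) := hswap.symm
    _ = ∫ t, ∫ r, ∫ s, (jostIntegrand q B (x, s) (t, r) : ℂ) * Complex.exp (2 * k * s * Complex.I)
        ∂jostMeasure ∂jostMeasure := integral_prod _ hint.integral_prod_left
    _ = ∫ t, (Ioi x).indicator (fun t => jostPhase k (t - x) * q t *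
        ∫ r, (B (t, r) : ℂ) * Complex.exp (2 * k * r * Complex.I) ∂jostMeasure) t := by
        refine integral_congr_ae (Eventually.of_forall fun t => ?_)
        calc _ = ∫ r, (Ioi x).indicator (fun t => jostPhase k (t - x) * q t) t *
              ((B (t, r) : ℂ) * Complex.exp (2 * k * r * Complex.I)) ∂jostMeasure :=
              integral_congr_ae (ae_jostMeasure_nonneg.mono fun r hr => hinner (t, r) hr)
          _ = _ := by
              rw [integral_const_mul]
              by_cases ht : t ∈ Ioi x <;> simp [ht]
    _ = _ := integral_indicator measurableSet_Ioi

/-! ### Convergence of the Neumann series -/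

theorem tendsto_integral_max_sub_mul {q : ℝ → ℝ} (hq : Measurable q)
    (hm : Integrable fun t => max t 0 * q t) :
    Tendsto (fun N : ℝ => ∫ t, max (t - N) 0 * |q t|) atTop (𝓝 0) := by
  suffices h : Tendsto (fun N : ℝ => ∫ t, max (t - N) 0 * |q t|) atTop (𝓝 (∫ _ : ℝ, (0 : ℝ))) by
    simpa only [integral_zero] using h
  refine tendsto_integral_filter_of_dominated_convergence (fun t => |max t 0 * q t|)
    (Eventually.of_forall fun N => (by fun_prop : Measurable _).aestronglyMeasurable) ?_
    hm.abs (Eventually.of_forall fun t => ?_)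
  · filter_upwards [eventually_ge_atTop 0] with N hN
    refine Eventually.of_forall fun t => ?_
    rw [Real.norm_eq_abs, abs_mul, abs_mul, abs_abs, abs_of_nonneg (le_max_right (t - N) 0),
      abs_of_nonneg (le_max_right t 0)]
    exact mul_le_mul_of_nonneg_right (max_le_max (by linarith) le_rfl) (abs_nonneg _)
  · refine tendsto_const_nhds.congr' ?_
    filter_upwards [eventually_ge_atTop t] with N hN
    rw [max_eq_right (by linarith), zero_mul]

/-- The weight `e^{-K min(x, N)}` absorbs the growth of `t - x` up to the threshold `N`. -/
theorem sub_mul_exp_weight_le {K N x t : ℝ} (hK : 0 < K) (hxt : x < t) :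
    (t - x) * Real.exp (-(K * min t N)) ≤
      Real.exp (-(K * min x N)) * (max (t - N) 0 + 1 / K) := by
  have key : ∀ r : ℝ, r * Real.exp (-(K * r)) ≤ 1 / K := by
    intro r
    have h1 := Real.mul_exp_neg_le_exp_neg_one (K * r)
    have h2 : Real.exp (-1) ≤ 1 := Real.exp_le_one_iff.2 (by norm_num)
    rw [le_div_iff₀ hK]
    linarith
  have hpos := Real.exp_pos (-(K * min x N))
  rcases le_or_gt t N with htN | htN
  · rw [min_eq_left htN, min_eq_left (by linarith), max_eq_right (by linarith), zero_add,
      show -(K * t) = -(K * x) + -(K * (t - x)) by ring, Real.exp_add]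
    have := key (t - x)
    have h0 := Real.exp_pos (-(K * x))
    nlinarith
  · rw [min_eq_right htN.le, max_eq_left (by linarith)]
    rcases le_or_gt x N with hxN | hxN
    · rw [min_eq_left hxN, show -(K * N) = -(K * x) + -(K * (N - x)) by ring, Real.exp_add]
      have h1 := key (N - x)
      have h0 := Real.exp_pos (-(K * x))
      have h2 : Real.exp (-(K * (N - x))) ≤ 1 := Real.exp_le_one_iff.2 (by nlinarith)
      have h3 : (t - x) * Real.exp (-(K * (N - x))) ≤ (t - N) + 1 / K := by nlinarith
      nlinarith
    · rw [min_eq_right hxN.le, mul_comm]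
      have : 0 < 1 / K := by positivity
      exact mul_le_mul_of_nonneg_left (by linarith) (Real.exp_pos _).le

theorem exists_volterra_weight {q : ℝ → ℝ} (hq : Measurable q) (hi : Integrable q)
    (hm : Integrable fun t => max t 0 * q t) :
    ∃ M : ℝ → ℝ, Antitone M ∧ (∀ x, 1 ≤ M x) ∧ ∀ x,
      ∫⁻ t in Ioi x, ENNReal.ofReal (t - x) * ‖q t‖ₑ * ENNReal.ofReal (M t) ≤
        ENNReal.ofReal (M x * (1 / 2)) := by
  obtain ⟨N, hN⟩ := ((tendsto_integral_max_sub_mul hq hm).eventually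
    (gt_mem_nhds (show (0 : ℝ) < 1 / 4 by norm_num))).exists
  obtain ⟨K, hK, hKq⟩ : ∃ K : ℝ, 0 < K ∧ (∫ t, |q t|) / K ≤ 1 / 4 := by
    have h0 : 0 ≤ ∫ t, |q t| := integral_nonneg fun _ => abs_nonneg _
    refine ⟨4 * (∫ t, |q t|) + 1, by linarith, ?_⟩
    rw [div_le_iff₀ (by linarith)]
    linarith
  refine ⟨fun x => Real.exp (K * N) * Real.exp (-(K * min x N)), ?_, ?_, ?_⟩
  · intro x y hxy
    refine mul_le_mul_of_nonneg_left (Real.exp_le_exp.2 (neg_le_neg ?_)) (Real.exp_pos _).le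
    exact mul_le_mul_of_nonneg_left (min_le_min_right _ hxy) hK.le
  · intro x
    simp only
    rw [← Real.exp_add, Real.one_le_exp_iff]
    nlinarith [min_le_right x N]
  · intro x
    set W : ℝ → ℝ := fun x => Real.exp (K * N) * Real.exp (-(K * min x N)) with hW
    have hWpos : ∀ x, 0 < W x := fun x => by positivity
    have hI1 : Integrable fun t => max (t - N) 0 * |q t| := by
      have : Integrable fun t => |max t 0 * q t| + |N| * |q t| :=
        hm.abs.add (hi.abs.const_mul _)
      refine this.mono' (by fun_prop : Measurable _).aestronglyMeasurable
        (Eventually.of_forall fun t => ?_)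
      rw [Real.norm_eq_abs, abs_mul, abs_mul, abs_abs, abs_of_nonneg (le_max_right (t - N) 0),
        abs_of_nonneg (le_max_right t 0), ← add_mul]
      refine mul_le_mul_of_nonneg_right ?_ (abs_nonneg _)
      exact max_le (by linarith [le_max_left t 0, neg_abs_le N])
        (add_nonneg (le_max_right _ _) (abs_nonneg _))
    have hI2 : Integrable fun t => W x * (max (t - N) 0 * |q t| + 1 / K * |q t|) :=
      (hI1.add (hi.abs.const_mul _)).const_mul _
    calc _ ≤ ∫⁻ t, ENNReal.ofReal (W x * (max (t - N) 0 * |q t| + 1 / K * |q t|)) := by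
          refine (setLIntegral_mono' measurableSet_Ioi fun t ht => ?_).trans
            (setLIntegral_le_lintegral _ _)
          have ht' : x < t := ht
          rw [← ofReal_norm, Real.norm_eq_abs, ← ENNReal.ofReal_mul (by linarith),
            ← ENNReal.ofReal_mul (mul_nonneg (by linarith) (abs_nonneg _))]
          apply ENNReal.ofReal_le_ofReal
          have h1 := sub_mul_exp_weight_le (N := N) hK ht'
          have h2 : (t - x) * W t ≤ W x * (max (t - N) 0 + 1 / K) := by
            have := mul_le_mul_of_nonneg_left h1 (Real.exp_pos (K * N)).le
            simp only [hW]
            linarith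
          have := mul_le_mul_of_nonneg_right h2 (abs_nonneg (q t))
          linarith
      _ = ENNReal.ofReal (W x * ((∫ t, max (t - N) 0 * |q t|) + (∫ t, |q t|) / K)) := by
          rw [← ofReal_integral_eq_lintegral_ofReal hI2, integral_const_mul,
            integral_add hI1 (hi.abs.const_mul _), integral_const_mul]
          · congr 2
            ring
          · refine Eventually.of_forall fun t => mul_nonneg (hWpos x).le ?_
            have := abs_nonneg (q t)
            have := le_max_right (t - N) 0
            positivity
      _ ≤ _ := by
          apply ENNReal.ofReal_le_ofReal
          exact mul_le_mul_of_nonneg_left (by linarith) (hWpos x).le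

/-- The bounds on the Neumann series: `M` dominates the mass of each term, up to a factor that
decays geometrically; the finiteness of `moment` justifies Fubini's theorem in the recursion. -/
structure IsJostMajorant (q M : ℝ → ℝ) : Prop where
  anti : Antitone M
  one_le : ∀ x, 1 ≤ M x
  mass : ∀ n x, ∫⁻ s, ‖jostIter q n (x, s)‖ₑ ∂jostMeasure ≤ ENNReal.ofReal (M x * (1 / 2) ^ n)
  moment : ∀ n x, ∫⁻ t in Ioi x, ENNReal.ofReal (t - x) * ‖q t‖ₑ *
    ∫⁻ r, ‖jostIter q n (t, r)‖ₑ ∂jostMeasure < ⊤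

theorem exists_isJostMajorant {q : ℝ → ℝ} (hq : Measurable q) (hi : Integrable q)
    (hm : Integrable fun t => max t 0 * q t) : ∃ M, IsJostMajorant q M := by
  obtain ⟨M, hanti, hone, hM⟩ := exists_volterra_weight hq hi hm
  have hMm : Measurable M := hanti.measurable
  have hmom : ∀ n, (∀ x, ∫⁻ s, ‖jostIter q n (x, s)‖ₑ ∂jostMeasure ≤
        ENNReal.ofReal (M x * (1 / 2) ^ n)) → ∀ x,
      ∫⁻ t in Ioi x, ENNReal.ofReal (t - x) * ‖q t‖ₑ *
        ∫⁻ r, ‖jostIter q n (t, r)‖ₑ ∂jostMeasure ≤ ENNReal.ofReal (M x * (1 / 2) ^ (n + 1)) := by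
    intro n hn x
    calc _ ≤ ∫⁻ t in Ioi x, ENNReal.ofReal ((1 / 2) ^ n) *
          (ENNReal.ofReal (t - x) * ‖q t‖ₑ * ENNReal.ofReal (M t)) := by
          refine lintegral_mono fun t => ?_
          refine (mul_le_mul_right (hn t) _).trans (le_of_eq ?_)
          rw [mul_comm (M t), ENNReal.ofReal_mul (by positivity)]
          ring
      _ ≤ ENNReal.ofReal ((1 / 2) ^ n) * ENNReal.ofReal (M x * (1 / 2)) := by
          rw [lintegral_const_mul _ (by fun_prop)]
          exact mul_le_mul_right (hM x) _
      _ = _ := by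
          rw [← ENNReal.ofReal_mul (by positivity)]
          congr 1
          ring
  have hmass : ∀ n x, ∫⁻ s, ‖jostIter q n (x, s)‖ₑ ∂jostMeasure ≤
      ENNReal.ofReal (M x * (1 / 2) ^ n) := by
    intro n
    induction n with
    | zero =>
      intro x
      rw [lintegral_jostMeasure, setLIntegral_congr_fun (g := fun _ => 0) measurableSet_Ioi]
      · simp only [jostIter, if_true, lintegral_zero, add_zero, pow_zero, mul_one]
        rw [← ofReal_norm]
        exact ENNReal.ofReal_le_ofReal (by simpa using hone x)
      · intro s hs
        simp [jostIter, (show (0 : ℝ) < s from hs).ne']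
    | succ n ih =>
      intro x
      exact (lintegral_enorm_jostStep_le hq (measurable_jostIter hq n) x).trans (hmom n ih x)
  exact ⟨M, hanti, hone, hmass, fun n x => (hmom n (hmass n) x).trans_lt ENNReal.ofReal_lt_top⟩

namespace IsJostMajorant

variable {q M : ℝ → ℝ}

theorem pos (h : IsJostMajorant q M) (x : ℝ) : 0 < M x := one_pos.trans_le (h.one_le x)

theorem abs_jostIter_succ_le (h : IsJostMajorant q M) (hq : Measurable q) (hi : Integrable q)
    (n : ℕ) (y : ℝ × ℝ) :
    |jostIter q (n + 1) y| ≤ (∫ t, |q t|) * M y.1 * (1 / 2) ^ n := by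
  have h0 : 0 ≤ ∫ t, |q t| := integral_nonneg fun _ => abs_nonneg _
  have hp := (h.pos y.1).le
  have h1 : ‖jostIter q (n + 1) y‖ₑ ≤
      ENNReal.ofReal ((∫ t, |q t|) * M y.1 * (1 / 2) ^ n) := by
    calc _ ≤ ∫⁻ t in Ioi y.1, ‖q t‖ₑ * ∫⁻ r, ‖jostIter q n (t, r)‖ₑ ∂jostMeasure :=
          enorm_jostStep_le hq (measurable_jostIter hq n) y
      _ ≤ ∫⁻ t in Ioi y.1, ‖q t‖ₑ * ENNReal.ofReal (M y.1 * (1 / 2) ^ n) := by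
          refine setLIntegral_mono' measurableSet_Ioi fun t ht => ?_
          refine mul_le_mul_right ((h.mass n t).trans (ENNReal.ofReal_le_ofReal ?_)) _
          exact mul_le_mul_of_nonneg_right (h.anti (le_of_lt ht)) (by positivity)
      _ ≤ ∫⁻ t, ‖q t‖ₑ * ENNReal.ofReal (M y.1 * (1 / 2) ^ n) := setLIntegral_le_lintegral _ _
      _ = _ := by
          rw [lintegral_mul_const _ hq.enorm, ← ofReal_integral_norm_eq_lintegral_enorm hi,
            ← ENNReal.ofReal_mul (integral_nonneg fun _ => norm_nonneg _)]
          congr 1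
          simp only [Real.norm_eq_abs]
          ring
  rw [← ofReal_norm, Real.norm_eq_abs] at h1
  exact (ENNReal.ofReal_le_ofReal_iff (by positivity)).1 h1

theorem summable_norm_jostIter (h : IsJostMajorant q M) (hq : Measurable q) (hi : Integrable q)
    (y : ℝ × ℝ) : Summable fun n => ‖jostIter q n y‖ := by
  rw [← summable_nat_add_iff 1]
  refine Summable.of_nonneg_of_le (fun n => norm_nonneg _)
    (fun n => h.abs_jostIter_succ_le hq hi n y) ?_
  exact (summable_geometric_of_lt_one (by norm_num) (by norm_num)).mul_left _

theorem jostKernel_eq_add_tsum (h : IsJostMajorant q M) (hq : Measurable q) (hi : Integrable q)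
    (y : ℝ × ℝ) : jostKernel q y = jostIter q 0 y + ∑' n, jostIter q (n + 1) y :=
  (h.summable_norm_jostIter hq hi y).of_norm.tsum_eq_zero_add

theorem jostKernel_zero (h : IsJostMajorant q M) (hq : Measurable q) (hi : Integrable q)
    (x : ℝ) : jostKernel q (x, 0) = 1 := by
  rw [h.jostKernel_eq_add_tsum hq hi]
  have : ∀ n, jostIter q (n + 1) (x, 0) = 0 := fun n => jostStep_of_nonpos le_rfl
  simp only [this, tsum_zero, add_zero]
  simp [jostIter]

theorem abs_jostKernel_le (h : IsJostMajorant q M) (hq : Measurable q) (hi : Integrable q)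
    {x s : ℝ} (hs : 0 < s) : |jostKernel q (x, s)| ≤ 2 * (∫ t, |q t|) * M x := by
  rw [h.jostKernel_eq_add_tsum hq hi, show jostIter q 0 (x, s) = 0 by simp [jostIter, hs.ne'],
    zero_add]
  have hg := (hasSum_geometric_of_lt_one (r := (1 / 2 : ℝ)) (by norm_num) (by norm_num)).mul_left
    ((∫ t, |q t|) * M x)
  refine (tsum_of_norm_bounded (f := fun n => jostIter q (n + 1) (x, s)) hg fun n =>
    h.abs_jostIter_succ_le hq hi n (x, s)).trans (le_of_eq ?_)
  norm_num
  ring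

theorem lintegral_jostKernel_le (h : IsJostMajorant q M) (hq : Measurable q) (x : ℝ) :
    ∫⁻ s, ‖jostKernel q (x, s)‖ₑ ∂jostMeasure ≤ ENNReal.ofReal (2 * M x) := by
  calc _ ≤ ∫⁻ s, ∑' n, ‖jostIter q n (x, s)‖ₑ ∂jostMeasure :=
        lintegral_mono fun s => enorm_tsum_le_tsum_enorm
    _ = ∑' n, ∫⁻ s, ‖jostIter q n (x, s)‖ₑ ∂jostMeasure :=
        lintegral_tsum fun n => by
          have := measurable_jostIter hq n
          fun_prop
    _ ≤ ∑' n : ℕ, ENNReal.ofReal (M x * (1 / 2) ^ n) := ENNReal.tsum_le_tsum fun n => h.mass n x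
    _ = _ := by
        have hp := (h.pos x).le
        rw [← ENNReal.ofReal_tsum_of_nonneg (fun n => by positivity)
          ((summable_geometric_of_lt_one (by norm_num) (by norm_num)).mul_left _), tsum_mul_left,
          tsum_geometric_of_lt_one (by norm_num) (by norm_num)]
        congr 1
        norm_num
        ring

end IsJostMajorant

theorem jostIter_eq_zero_of_lt {q : ℝ → ℝ} {b : ℝ} (hb : ∀ t, b < t → q t = 0) (n : ℕ) {x s : ℝ}
    (hs : 0 < s) (hxs : b < x + s) : jostIter q n (x, s) = 0 := by
  induction n generalizing x s with
  | zero => simp [jostIter, hs.ne']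
  | succ n ih =>
    simp only [jostIter, jostStep]
    rw [integral_eq_zero_of_ae]
    have hae : ∀ᵐ z : ℝ × ℝ ∂(volume.prod jostMeasure), 0 ≤ z.2 :=
      Measure.quasiMeasurePreserving_snd.ae ae_jostMeasure_nonneg
    filter_upwards [hae] with z hz
    unfold jostIntegrand
    split_ifs with h
    · obtain ⟨-, -, -, h4⟩ := h
      simp only at h4
      by_cases hz1 : b < z.1
      · simp [hb _ hz1]
      · have : 0 < z.2 := by linarith
        rw [show z = (z.1, z.2) from rfl, ih this (by linarith)]
        simp
    · rfl

theorem jostKernel_eq_zero_of_lt {q : ℝ → ℝ} {b : ℝ} (hb : ∀ t, b < t → q t = 0) {x s : ℝ}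
    (hs : 0 < s) (hxs : b < x + s) : jostKernel q (x, s) = 0 := by
  simp [jostKernel, jostIter_eq_zero_of_lt hb _ hs hxs]

/-! ### From the Volterra equation to the Schrödinger equation -/

/-- Differentiation of a Volterra integral whose kernel vanishes on the diagonal; the density `w`
need not be continuous. -/
theorem hasDerivAt_volterra {S S' : ℝ → ℂ} (hS : ∀ r, HasDerivAt S (S' r) r) (hS0 : S 0 = 0)
    (hS'm : Measurable S') {C : NNReal} (hS' : ∀ r, ‖S' r‖₊ ≤ C) {D : ℝ}
    (hD : ∀ r, ‖S r‖ ≤ D) {w : ℝ → ℂ} (hw : Integrable w)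
    (x : ℝ) :
    HasDerivAt (fun x => ∫ t in Ioi x, S (t - x) * w t) (-∫ t in Ioi x, S' (t - x) * w t) x := by
  have hScont : Continuous S := continuous_iff_continuousAt.2 fun r => (hS r).continuousAt
  have hlip : LipschitzWith C S := lipschitzWith_of_nnnorm_deriv_le
    (fun r => (hS r).differentiableAt) (fun r => by rw [(hS r).deriv]; exact hS' r)
  have hF : ∀ x : ℝ, ∫ t in Ioi x, S (t - x) * w t = ∫ t, S (max (t - x) 0) * w t := by
    intro x
    rw [← integral_indicator measurableSet_Ioi]
    refine integral_congr_ae (Eventually.of_forall fun t => ?_)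
    by_cases ht : x < t
    · simp only [indicator_of_mem (show t ∈ Ioi x from ht), max_eq_left (sub_nonneg.2 ht.le)]
    · simp only [indicator_of_notMem (show t ∉ Ioi x from ht),
        max_eq_right (sub_nonpos.2 (not_lt.1 ht)), hS0, zero_mul]
  have hF' : -∫ t in Ioi x, S' (t - x) * w t =
      ∫ t, -(Ioi x).indicator (fun t => S' (t - x) * w t) t := by
    rw [integral_neg, integral_indicator measurableSet_Ioi]
  rw [hF', funext hF]
  have hmeas : ∀ y : ℝ, AEStronglyMeasurable (fun t => S (max (t - y) 0) * w t) volume := fun y =>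
    (hScont.comp (by fun_prop : Continuous fun t : ℝ => max (t - y) 0)).aestronglyMeasurable.mul
      hw.aestronglyMeasurable
  refine (hasDerivAt_integral_of_dominated_loc_of_lip (F := fun y t => S (max (t - y) 0) * w t)
    (bound := fun t => C * ‖w t‖) (s := Metric.ball x 1) (Metric.ball_mem_nhds x one_pos)
    (Eventually.of_forall hmeas) ?_ ?_ ?_ (hw.norm.const_mul _) ?_).2
  · exact hw.bdd_mul (hScont.comp (by fun_prop : Continuous fun t : ℝ =>
      max (t - x) 0)).aestronglyMeasurable (Eventually.of_forall fun t => hD _)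
  · refine (AEStronglyMeasurable.indicator ?_ measurableSet_Ioi).neg
    exact (hS'm.comp (measurable_id.sub_const x)).aestronglyMeasurable.mul hw.aestronglyMeasurable
  · refine Eventually.of_forall fun t => LipschitzOnWith.of_dist_le_mul fun y _ z _ => ?_
    have h1 : dist (max (t - y) 0) (max (t - z) 0) ≤ dist y z := by
      rw [Real.dist_eq, Real.dist_eq]
      refine (abs_max_sub_max_le_abs _ _ _).trans (le_of_eq ?_)
      rw [show t - y - (t - z) = -(y - z) by ring, abs_neg]
    have h2 := (hlip.dist_le_mul (max (t - y) 0) (max (t - z) 0))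
    rw [Real.coe_nnabs, abs_of_nonneg (by positivity), dist_eq_norm, ← sub_mul, norm_mul,
      ← dist_eq_norm]
    have h3 := h2.trans (mul_le_mul_of_nonneg_left h1 C.2)
    have h4 := mul_le_mul_of_nonneg_right h3 (norm_nonneg (w t))
    linarith
  · have : ∀ᵐ t : ℝ, t ≠ x := by simp [ae_iff]
    filter_upwards [this] with t ht
    rcases lt_or_gt_of_ne ht with h | h
    · rw [indicator_of_notMem (show t ∉ Ioi x from h.not_gt), neg_zero]
      refine (hasDerivAt_const x (0 : ℂ)).congr_of_eventuallyEq ?_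
      filter_upwards [lt_mem_nhds h] with y hy
      rw [max_eq_right (by linarith), hS0, zero_mul]
    · rw [indicator_of_mem (show t ∈ Ioi x from h)]
      have h1 : HasDerivAt (fun y => S (t - y) * w t) (-(S' (t - x) * w t)) x := by
        have := ((hS (t - x)).scomp x ((hasDerivAt_id x).const_sub t)).mul_const (w t)
        simpa using this
      refine h1.congr_of_eventuallyEq ?_
      filter_upwards [gt_mem_nhds h] with y hy
      rw [max_eq_left (by linarith)]

theorem hasDerivAt_exp_mul_I (k x : ℝ) : HasDerivAt (fun x : ℝ => Complex.exp (k * x * Complex.I))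
    (k * Complex.I * Complex.exp (k * x * Complex.I)) x := by
  have h : HasDerivAt (fun x : ℝ => (k * x * Complex.I : ℂ)) (k * 1 * Complex.I) x :=
    ((Complex.ofRealCLM.hasDerivAt (x := x)).const_mul (k : ℂ)).mul_const Complex.I
  refine h.cexp.congr_deriv ?_
  ring

theorem hasDerivAt_ofReal_sin (k r : ℝ) :
    HasDerivAt (fun r : ℝ => ((Real.sin (k * r) : ℝ) : ℂ)) ((k * Real.cos (k * r) : ℝ) : ℂ) r := by
  have h := (((hasDerivAt_id r).const_mul k).sin).ofReal_comp
  simpa [mul_comm] using h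

theorem hasDerivAt_ofReal_cos (k r : ℝ) :
    HasDerivAt (fun r : ℝ => ((Real.cos (k * r) : ℝ) : ℂ))
      ((-(k * Real.sin (k * r)) : ℝ) : ℂ) r := by
  have h := (((hasDerivAt_id r).const_mul k).cos).ofReal_comp
  simpa [mul_comm] using h

/-- A solution of the Volterra equation `f = e^{ikx} + ∫_{t > x} sin (k (t - x)) / k q f` solves the
Schrödinger equation.  No continuity of `q` is available, so both derivatives are taken of Volterra
integrals whose kernel vanishes on the diagonal: `sin (kr) / k` for `f`, and `cos (kr) - 1` for
`f' + ∫_{t > x} q f`. -/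
theorem isSchrodingerSolution_of_volterra {q : ℝ → ℝ} (hi : Integrable q)
    {k : ℝ} (hk : k ≠ 0) {f : ℝ → ℂ} (hfm : StronglyMeasurable f) {D : ℝ → ℝ}
    (hD : ∀ a x, a ≤ x → ‖f x‖ ≤ D a)
    (hf : ∀ x, f x = Complex.exp (k * x * Complex.I) +
      ∫ t in Ioi x, ((Real.sin (k * (t - x)) / k : ℝ) : ℂ) * (q t * f t)) :
    IsSchrodingerSolution q k univ f (fun x => k * Complex.I * Complex.exp (k * x * Complex.I) -
      ∫ t in Ioi x, ((Real.cos (k * (t - x)) : ℝ) : ℂ) * (q t * f t)) := by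
  -- only the part of `q f` to the right of a given point is integrable
  set w : ℝ → ℝ → ℂ := fun a => (Ioi a).indicator fun t => q t * f t with hw
  have hwi : ∀ a, Integrable (w a) := by
    intro a
    rw [hw, integrable_indicator_iff measurableSet_Ioi]
    refine hi.ofReal.integrableOn.mul_bdd (c := D a) hfm.aestronglyMeasurable ?_
    filter_upwards [ae_restrict_mem measurableSet_Ioi] with t ht using hD a t (le_of_lt ht)
  have hwint : ∀ {a x : ℝ}, a ≤ x → ∀ S : ℝ → ℂ,
      ∫ t in Ioi x, S t * (q t * f t) = ∫ t in Ioi x, S t * w a t := by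
    intro a x hax S
    refine setIntegral_congr_fun measurableSet_Ioi fun t ht => ?_
    simp only [hw, indicator_of_mem (show t ∈ Ioi a from lt_of_le_of_lt hax ht)]
  have hkn : ∀ r : ℝ, ‖((Real.cos (k * r) : ℝ) : ℂ)‖₊ ≤ 1 := by
    intro r
    rw [← NNReal.coe_le_coe, coe_nnnorm, Complex.norm_real]
    exact Real.abs_cos_le_one _
  -- the derivative of `f`
  have hderiv : ∀ x : ℝ, HasDerivAt f (k * Complex.I * Complex.exp (k * x * Complex.I) -
      ∫ t in Ioi x, ((Real.cos (k * (t - x)) : ℝ) : ℂ) * (q t * f t)) x := by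
    intro x
    have hS : ∀ r : ℝ, HasDerivAt (fun r : ℝ => ((Real.sin (k * r) / k : ℝ) : ℂ))
        ((Real.cos (k * r) : ℝ) : ℂ) r := by
      intro r
      have := (hasDerivAt_ofReal_sin k r).div_const (k : ℂ)
      have hk' : (k : ℂ) ≠ 0 := by exact_mod_cast hk
      refine (this.congr_deriv ?_).congr_of_eventuallyEq (Eventually.of_forall fun r => ?_)
      · push_cast
        field_simp
      · push_cast
        rfl
    have h1 := hasDerivAt_volterra hS (by simp)
      (by fun_prop : Measurable fun r : ℝ => ((Real.cos (k * r) : ℝ) : ℂ)) hkn (D := 1 / |k|)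
      (fun r => by
        rw [Complex.norm_real, Real.norm_eq_abs, abs_div]
        exact div_le_div_of_nonneg_right (Real.abs_sin_le_one _) (abs_nonneg _))
      (hwi (x - 1)) x
    have h2 := (hasDerivAt_exp_mul_I k x).add h1
    rw [hwint (show x - 1 ≤ x by linarith) fun t => ((Real.cos (k * (t - x)) : ℝ) : ℂ),
      sub_eq_add_neg]
    refine h2.congr_of_eventuallyEq ?_
    filter_upwards [lt_mem_nhds (show x - 1 < x by linarith)] with y hy
    rw [hf y, hwint hy.le fun t => ((Real.sin (k * (t - y)) / k : ℝ) : ℂ)]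
    rfl
  have hfc : Continuous f := continuous_iff_continuousAt.2 fun x => (hderiv x).continuousAt
  have hqf : ∀ x y, IntervalIntegrable (fun t => q t * f t) volume x y := by
    intro x y
    rw [intervalIntegrable_iff]
    refine ((integrable_indicator_iff measurableSet_Ioi).1 (hwi (min x y))).mono_set ?_
    exact fun t ht => ht.1
  have hkf : ∀ x y, IntervalIntegrable (fun t => (k ^ 2 : ℂ) * f t) volume x y := fun x y =>
    (hfc.const_smul (k ^ 2 : ℂ)).intervalIntegrable x y
  have hsplit : (fun t => ((q t - k ^ 2 : ℝ) : ℂ) * f t) =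
      fun t => q t * f t - (k ^ 2 : ℂ) * f t := by
    ext t
    push_cast
    ring
  refine ⟨fun x _ => (hderiv x).hasDerivWithinAt, fun x _ y _ => ?_, fun x _ y _ => ?_⟩
  · rw [hsplit]
    exact (hqf x y).sub (hkf x y)
  · rw [hsplit, intervalIntegral.integral_sub (hqf x y) (hkf x y)]
    set a := min x y - 1 with ha
    have hax : a < x := by have := min_le_left x y; linarith
    have hay : a < y := by have := min_le_right x y; linarith
    -- `v = f' + ∫_{t > x} q f` is continuously differentiable
    have hS : ∀ r : ℝ, HasDerivAt (fun r : ℝ => ((Real.cos (k * r) : ℝ) : ℂ) - 1)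
        ((-(k * Real.sin (k * r)) : ℝ) : ℂ) r := fun r => (hasDerivAt_ofReal_cos k r).sub_const 1
    have hv : ∀ z, a < z → HasDerivAt
        (fun z : ℝ => k * Complex.I * Complex.exp (k * z * Complex.I) -
          ∫ t in Ioi z, (((Real.cos (k * (t - z)) : ℝ) : ℂ) - 1) * w a t)
        (-((k ^ 2 : ℂ) * f z)) z := by
      intro z hz
      have h1 := hasDerivAt_volterra hS (by simp) (by fun_prop) (C := ‖k‖₊) (fun r => by
          rw [← NNReal.coe_le_coe, coe_nnnorm, coe_nnnorm, Complex.norm_real, norm_neg, norm_mul]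
          exact mul_le_of_le_one_right (norm_nonneg _) (Real.abs_sin_le_one _)) (D := 2)
        (fun r => by
          refine (norm_sub_le _ _).trans ?_
          have := hkn r
          rw [← NNReal.coe_le_coe, coe_nnnorm, NNReal.coe_one] at this
          rw [norm_one]
          linarith) (hwi a) z
      refine (((hasDerivAt_exp_mul_I k z).const_mul (k * Complex.I : ℂ)).sub h1).congr_deriv ?_
      rw [hf z, hwint hz.le fun t => ((Real.sin (k * (t - z)) / k : ℝ) : ℂ), mul_add, neg_add,
        ← integral_const_mul, sub_neg_eq_add]
      congr 1
      · linear_combination (k ^ 2 * Complex.exp (k * z * Complex.I) : ℂ) * Complex.I_mul_I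
      · rw [← integral_neg]
        refine integral_congr_ae (Eventually.of_forall fun t => ?_)
        have hk' : (k : ℂ) ≠ 0 := by exact_mod_cast hk
        push_cast
        field_simp
    have hsub : ∀ t ∈ uIcc x y, a < t := by
      intro t ht
      have := ht.1
      have : min x y ≤ t := ht.1
      linarith
    have hFTC := intervalIntegral.integral_eq_sub_of_hasDerivAt (a := x) (b := y)
      (fun t ht => hv t (hsub t ht)) (hkf x y).neg
    have hIoi := intervalIntegral.integral_Ioi_sub_Ioi' (f := w a) (a := x) (b := y)
      (hwi a).integrableOn (hwi a).integrableOn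
    have hwq : ∫ t in x..y, w a t = ∫ t in x..y, q t * f t := by
      refine intervalIntegral.integral_congr fun t ht => ?_
      simp only [hw, indicator_of_mem (show t ∈ Ioi a from hsub t ht)]
    have hcos : ∀ z, a < z → ∫ t in Ioi z, (((Real.cos (k * (t - z)) : ℝ) : ℂ) - 1) * w a t =
        (∫ t in Ioi z, ((Real.cos (k * (t - z)) : ℝ) : ℂ) * (q t * f t)) - ∫ t in Ioi z, w a t := by
      intro z hz
      rw [hwint hz.le fun t => ((Real.cos (k * (t - z)) : ℝ) : ℂ), ← integral_sub]
      · simp only [sub_mul, one_mul]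
      · refine ((hwi a).bdd_mul (c := 1) (Measurable.aestronglyMeasurable (by fun_prop))
          (Eventually.of_forall fun t => ?_)).integrableOn
        have := hkn (t - z)
        rwa [← NNReal.coe_le_coe, coe_nnnorm, NNReal.coe_one] at this
      · exact (hwi a).integrableOn
    rw [intervalIntegral.integral_neg, hcos x hax, hcos y hay] at hFTC
    rw [← hwq, ← hIoi]
    linear_combination -hFTC

/-! ### The Jost solution of a potential on the line -/

/-- The transform `∫ B(x, s) e^{2iks} (δ₀ + ds)` of a kernel in its second variable. -/
noncomputable def jostTransform (B : ℝ × ℝ → ℝ) (k x : ℝ) : ℂ :=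
  ∫ s, (B (x, s) : ℂ) * Complex.exp (2 * k * s * Complex.I) ∂jostMeasure

/-- The Jost solution of a potential on the whole line, given through its kernel. -/
noncomputable def jostFun (q : ℝ → ℝ) (k x : ℝ) : ℂ :=
  Complex.exp (k * x * Complex.I) * jostTransform (jostKernel q) k x

theorem norm_exp_two_mul (k s : ℝ) : ‖Complex.exp (2 * k * s * Complex.I)‖ = 1 := by
  rw [show (2 * k * s : ℂ) = ((2 * k * s : ℝ) : ℂ) by push_cast; ring,
    Complex.norm_exp_ofReal_mul_I]

theorem norm_exp_mul (k x : ℝ) : ‖Complex.exp (k * x * Complex.I)‖ = 1 := by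
  rw [← Complex.ofReal_mul, Complex.norm_exp_ofReal_mul_I]

theorem norm_jostTransform_le {B : ℝ × ℝ → ℝ} {x C : ℝ} (hC : 0 ≤ C)
    (h : ∫⁻ s, ‖B (x, s)‖ₑ ∂jostMeasure ≤ ENNReal.ofReal C) (k : ℝ) :
    ‖jostTransform B k x‖ ≤ C := by
  have h1 : ‖jostTransform B k x‖ₑ ≤ ENNReal.ofReal C := by
    refine (enorm_integral_le_lintegral_enorm _).trans (le_trans (le_of_eq ?_) h)
    refine lintegral_congr fun s => ?_
    rw [← ofReal_norm, ← ofReal_norm, norm_mul, norm_exp_two_mul, mul_one, Complex.norm_real]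
  rw [← ofReal_norm] at h1
  exact (ENNReal.ofReal_le_ofReal_iff hC).1 h1

theorem stronglyMeasurable_jostTransform {B : ℝ × ℝ → ℝ} (hB : Measurable B) (k : ℝ) :
    StronglyMeasurable (jostTransform B k) :=
  StronglyMeasurable.integral_prod_right (ν := jostMeasure)
    (f := fun x s => (B (x, s) : ℂ) * Complex.exp (2 * k * s * Complex.I))
    (Measurable.stronglyMeasurable (by fun_prop))

theorem stronglyMeasurable_jostFun {q : ℝ → ℝ} (hq : Measurable q) (k : ℝ) :
    StronglyMeasurable (jostFun q k) :=
  (Measurable.stronglyMeasurable (by fun_prop)).mul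
    (stronglyMeasurable_jostTransform (measurable_jostKernel hq) k)

theorem norm_jostPhase_le {k : ℝ} (hk : k ≠ 0) (r : ℝ) : ‖jostPhase k r‖ ≤ 1 / |k| := by
  rw [jostPhase, norm_div, norm_mul, norm_mul, Complex.norm_I, mul_one, Complex.norm_real,
    Real.norm_eq_abs, Complex.norm_ofNat]
  have hk' := abs_pos.2 hk
  rw [div_le_div_iff₀ (by positivity) hk']
  have := norm_sub_le (Complex.exp (2 * k * r * Complex.I)) 1
  rw [norm_exp_two_mul, norm_one] at this
  nlinarith

theorem exp_neg_mul_jostPhase {k : ℝ} (hk : k ≠ 0) (r : ℝ) :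
    Complex.exp (-(k * r * Complex.I)) * jostPhase k r = ((Real.sin (k * r) / k : ℝ) : ℂ) := by
  have hk' : (k : ℂ) ≠ 0 := by exact_mod_cast hk
  have hE := Complex.exp_ne_zero (k * r * Complex.I)
  rw [jostPhase, show (2 * k * r * Complex.I : ℂ) = k * r * Complex.I + k * r * Complex.I by ring,
    Complex.exp_add, Complex.exp_neg]
  push_cast
  rw [Complex.sin, show -(k * r : ℂ) * Complex.I = -(k * r * Complex.I) by ring, Complex.exp_neg]
  have hI := Complex.I_ne_zero
  field_simp
  rw [Complex.I_sq]
  ring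

namespace IsJostMajorant

variable {q M : ℝ → ℝ}

theorem integrable_jostIter (h : IsJostMajorant q M) (hq : Measurable q) (n : ℕ) (x : ℝ) :
    Integrable (fun s => jostIter q n (x, s)) jostMeasure :=
  ⟨((measurable_jostIter hq n).comp measurable_prodMk_left).aestronglyMeasurable,
    (h.mass n x).trans_lt ENNReal.ofReal_lt_top⟩

theorem norm_jostTransform_jostIter_le (h : IsJostMajorant q M) (n : ℕ) (k x : ℝ) :
    ‖jostTransform (jostIter q n) k x‖ ≤ M x * (1 / 2) ^ n := by
  have := h.pos x
  exact norm_jostTransform_le (by positivity) (h.mass n x) k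

theorem norm_jostFun_le (h : IsJostMajorant q M) (hq : Measurable q) (k x : ℝ) :
    ‖jostFun q k x‖ ≤ 2 * M x := by
  have := h.pos x
  rw [jostFun, norm_mul, norm_exp_mul, one_mul]
  exact norm_jostTransform_le (by positivity) (h.lintegral_jostKernel_le hq x) k

theorem hasSum_jostTransform (h : IsJostMajorant q M) (hq : Measurable q) (k x : ℝ) :
    HasSum (fun n => jostTransform (jostIter q n) k x) (jostTransform (jostKernel q) k x) := by
  have hM := (h.pos x).le
  have hI : ∀ n, Integrable (fun s => (jostIter q n (x, s) : ℂ) *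
      Complex.exp (2 * k * s * Complex.I)) jostMeasure := fun n =>
    (h.integrable_jostIter hq n x).ofReal.mul_bdd (c := 1)
      (Measurable.aestronglyMeasurable (by fun_prop))
      (Eventually.of_forall fun s => (norm_exp_two_mul k s).le)
  have hnorm : ∀ n, ∫ s, ‖(jostIter q n (x, s) : ℂ) * Complex.exp (2 * k * s * Complex.I)‖
      ∂jostMeasure ≤ M x * (1 / 2) ^ n := by
    intro n
    have h1 := h.mass n x
    rw [← ofReal_integral_norm_eq_lintegral_enorm (h.integrable_jostIter hq n x),
      ENNReal.ofReal_le_ofReal_iff (by positivity)] at h1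
    simpa only [norm_mul, norm_exp_two_mul, mul_one, Complex.norm_real] using h1
  have hs := hasSum_integral_of_summable_integral_norm hI
    (Summable.of_nonneg_of_le (fun n => integral_nonneg fun s => norm_nonneg _) hnorm
      ((summable_geometric_of_lt_one (by norm_num) (by norm_num)).mul_left _))
  have hEq : jostTransform (jostKernel q) k x =
      ∫ s, ∑' n, (jostIter q n (x, s) : ℂ) * Complex.exp (2 * k * s * Complex.I) ∂jostMeasure := by
    unfold jostTransform
    refine integral_congr_ae (Eventually.of_forall fun s => ?_)
    simp only [jostKernel, tsum_mul_right, Complex.ofReal_tsum]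
  rw [hEq]
  exact hs

theorem jostTransform_volterra (h : IsJostMajorant q M) (hq : Measurable q) (hi : Integrable q)
    {k : ℝ} (hk : k ≠ 0) (x : ℝ) :
    jostTransform (jostKernel q) k x =
      1 + ∫ t in Ioi x, jostPhase k (t - x) * q t * jostTransform (jostKernel q) k t := by
  have hM := (h.pos x).le
  have hk0 := abs_pos.2 hk
  have hphase : Measurable (jostPhase k) := by unfold jostPhase; fun_prop
  have hm : ∀ n, AEStronglyMeasurable (fun t => jostPhase k (t - x) *
      jostTransform (jostIter q n) k t) (volume.restrict (Ioi x)) := fun n =>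
    ((hphase.comp (measurable_id.sub_const x)).aestronglyMeasurable).mul
      (stronglyMeasurable_jostTransform (measurable_jostIter hq n) k).aestronglyMeasurable
  have hb : ∀ n, ∀ᵐ t ∂(volume.restrict (Ioi x)), ‖jostPhase k (t - x) *
      jostTransform (jostIter q n) k t‖ ≤ 1 / |k| * (M x * (1 / 2) ^ n) := by
    intro n
    filter_upwards [ae_restrict_mem measurableSet_Ioi] with t ht
    rw [norm_mul]
    refine mul_le_mul (norm_jostPhase_le hk _) ((h.norm_jostTransform_jostIter_le n k t).trans ?_)
      (norm_nonneg _) (by positivity)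
    exact mul_le_mul_of_nonneg_right (h.anti (le_of_lt ht)) (by positivity)
  have hcomm : ∀ (n : ℕ) (t : ℝ), jostPhase k (t - x) * q t * jostTransform (jostIter q n) k t =
      q t * (jostPhase k (t - x) * jostTransform (jostIter q n) k t) := fun n t => by ring
  have hI : ∀ n, Integrable (fun t => jostPhase k (t - x) * q t *
      jostTransform (jostIter q n) k t) (volume.restrict (Ioi x)) := by
    intro n
    simp only [hcomm]
    exact hi.ofReal.integrableOn.mul_bdd (hm n) (hb n)
  have hnorm : ∀ n, ∫ t in Ioi x, ‖jostPhase k (t - x) * q t * jostTransform (jostIter q n) k t‖ ≤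
      (∫ t in Ioi x, |q t|) * (1 / |k| * M x) * (1 / 2) ^ n := by
    intro n
    have : ∫ t in Ioi x, ‖jostPhase k (t - x) * q t * jostTransform (jostIter q n) k t‖ ≤
        ∫ t in Ioi x, |q t| * (1 / |k| * (M x * (1 / 2) ^ n)) := by
      refine integral_mono_ae (hI n).norm (hi.abs.integrableOn.mul_const _) ?_
      filter_upwards [hb n] with t ht
      rw [hcomm, norm_mul, Complex.norm_real, Real.norm_eq_abs]
      exact mul_le_mul_of_nonneg_left ht (abs_nonneg _)
    rw [integral_mul_const] at this
    linarith
  have hs := hasSum_integral_of_summable_integral_norm hI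
    (Summable.of_nonneg_of_le (fun n => integral_nonneg fun s => norm_nonneg _) hnorm
      ((summable_geometric_of_lt_one (by norm_num) (by norm_num)).mul_left _))
  have hstep : ∀ n, ∫ t in Ioi x, jostPhase k (t - x) * q t * jostTransform (jostIter q n) k t =
      jostTransform (jostIter q (n + 1)) k x := fun n =>
    (integral_jostStep_mul_exp hq (measurable_jostIter hq n) (h.moment n x) hk).symm
  have h0 : jostTransform (jostIter q 0) k x = 1 := by
    have hi0 : Integrable (fun s => (jostIter q 0 (x, s) : ℂ) *
        Complex.exp (2 * k * s * Complex.I)) jostMeasure :=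
      (h.integrable_jostIter hq 0 x).ofReal.mul_bdd (c := 1)
        (Measurable.aestronglyMeasurable (by fun_prop))
        (Eventually.of_forall fun s => (norm_exp_two_mul k s).le)
    rw [jostTransform, integral_jostMeasure hi0,
      setIntegral_congr_fun (g := fun _ => 0) measurableSet_Ioi]
    · simp [jostIter]
    · intro s hs
      simp [jostIter, (show (0 : ℝ) < s from hs).ne']
  rw [← (h.hasSum_jostTransform hq k x).tsum_eq,
    (h.hasSum_jostTransform hq k x).summable.tsum_eq_zero_add, h0]
  simp only [← hstep]
  rw [hs.tsum_eq]
  congr 1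
  refine integral_congr_ae (Eventually.of_forall fun t => ?_)
  simp only [tsum_mul_left, (h.hasSum_jostTransform hq k t).tsum_eq]

theorem jostFun_volterra (h : IsJostMajorant q M) (hq : Measurable q) (hi : Integrable q)
    {k : ℝ} (hk : k ≠ 0) (x : ℝ) :
    jostFun q k x = Complex.exp (k * x * Complex.I) +
      ∫ t in Ioi x, ((Real.sin (k * (t - x)) / k : ℝ) : ℂ) * (q t * jostFun q k t) := by
  rw [jostFun, h.jostTransform_volterra hq hi hk x, mul_add, mul_one, ← integral_const_mul]
  congr 1
  refine integral_congr_ae (Eventually.of_forall fun t => ?_)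
  have hE : Complex.exp (k * x * Complex.I) =
      Complex.exp (-(k * ((t - x : ℝ) : ℂ) * Complex.I)) * Complex.exp (k * t * Complex.I) := by
    rw [← Complex.exp_add]
    congr 1
    push_cast
    ring
  simp only [jostFun, ← exp_neg_mul_jostPhase hk]
  rw [hE]
  ring

theorem exists_isSchrodingerSolution (h : IsJostMajorant q M) (hq : Measurable q)
    (hi : Integrable q) {k : ℝ} (hk : k ≠ 0) :
    ∃ f', IsSchrodingerSolution q k univ (jostFun q k) f' ∧ ∀ b, (∀ t, b < t → q t = 0) →
      f' b = k * Complex.I * Complex.exp (k * b * Complex.I) := by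
  refine ⟨_, isSchrodingerSolution_of_volterra hi hk (stronglyMeasurable_jostFun hq k)
    (D := fun a => 2 * M a) (fun a x hax => (h.norm_jostFun_le hq k x).trans ?_)
    (h.jostFun_volterra hq hi hk), fun b hb => ?_⟩
  · have := h.anti hax
    linarith
  · rw [setIntegral_congr_fun (g := fun _ => 0) measurableSet_Ioi]
    · simp
    · intro t ht
      simp [hb t ht]

theorem jostFun_of_eq_zero (h : IsJostMajorant q M) (hq : Measurable q) (hi : Integrable q)
    {k : ℝ} (hk : k ≠ 0) {b : ℝ} (hb : ∀ t, b < t → q t = 0) :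
    jostFun q k b = Complex.exp (k * b * Complex.I) := by
  rw [h.jostFun_volterra hq hi hk, setIntegral_congr_fun (g := fun _ => 0) measurableSet_Ioi]
  · simp
  · intro t ht
    simp [hb t ht]

theorem tendsto_jostFun_sub_exp (h : IsJostMajorant q M) (hq : Measurable q) (hi : Integrable q)
    {k : ℝ} (hk : k ≠ 0) :
    Tendsto (fun x : ℝ => jostFun q k x - Complex.exp (k * x * Complex.I)) atTop (𝓝 0) := by
  have hM := (h.pos 0).le
  have hk0 := abs_pos.2 hk
  have hlim : Tendsto (fun x : ℝ => ∫ t, (Ioi x).indicator (fun t =>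
      ((Real.sin (k * (t - x)) / k : ℝ) : ℂ) * (q t * jostFun q k t)) t) atTop
      (𝓝 (∫ _ : ℝ, (0 : ℂ))) := by
    refine tendsto_integral_filter_of_dominated_convergence
      (fun t => 1 / |k| * (|q t| * (2 * M 0))) (Eventually.of_forall fun x => ?_) ?_
      ((hi.abs.mul_const _).const_mul _) (Eventually.of_forall fun t => ?_)
    · refine AEStronglyMeasurable.indicator ?_ measurableSet_Ioi
      exact (Measurable.aestronglyMeasurable (by fun_prop)).mul
        (hi.ofReal.aestronglyMeasurable.mul
          (stronglyMeasurable_jostFun hq k).aestronglyMeasurable)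
    · filter_upwards [eventually_ge_atTop 0] with x hx
      refine Eventually.of_forall fun t => ?_
      by_cases ht : x < t
      · rw [indicator_of_mem (show t ∈ Ioi x from ht), norm_mul, norm_mul, Complex.norm_real,
          Complex.norm_real, Real.norm_eq_abs, Real.norm_eq_abs, abs_div]
        refine mul_le_mul (div_le_div_of_nonneg_right (Real.abs_sin_le_one _) hk0.le) ?_
          (by positivity) (by positivity)
        refine mul_le_mul_of_nonneg_left ((h.norm_jostFun_le hq k t).trans ?_) (abs_nonneg _)
        have := h.anti (show (0 : ℝ) ≤ t by linarith)
        linarith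
      · rw [indicator_of_notMem (show t ∉ Ioi x from ht), norm_zero]
        positivity
    · refine tendsto_const_nhds.congr' ?_
      filter_upwards [eventually_ge_atTop t] with x hx
      rw [indicator_of_notMem (show t ∉ Ioi x from not_lt.2 hx)]
  rw [integral_zero] at hlim
  refine hlim.congr fun x => ?_
  rw [integral_indicator measurableSet_Ioi, h.jostFun_volterra hq hi hk x]
  ring

end IsJostMajorant

namespace IsSchrodingerSolution

variable {q q' : ℝ → ℝ} {k : ℝ} {I J : Set ℝ} {u u' v v' : ℝ → ℂ}

theorem mono (h : IsSchrodingerSolution q k J u u') (hIJ : I ⊆ J) :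
    IsSchrodingerSolution q k I u u' :=
  ⟨fun x hx => (h.hasDeriv x (hIJ hx)).mono hIJ,
    fun x hx y hy => h.integrable x (hIJ hx) y (hIJ hy),
    fun x hx y hy => h.integral_eq x (hIJ hx) y (hIJ hy)⟩

theorem congr_potential (h : IsSchrodingerSolution q k I u u') (hI : I.OrdConnected)
    (hIm : MeasurableSet I) (hqq' : q =ᵐ[volume.restrict I] q') :
    IsSchrodingerSolution q' k I u u' := by
  have hae : ∀ x ∈ I, ∀ y ∈ I, ∀ᵐ t, t ∈ uIoc x y →
      ((q t - k ^ 2 : ℝ) : ℂ) * u t = ((q' t - k ^ 2 : ℝ) : ℂ) * u t := by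
    intro x hx y hy
    filter_upwards [(ae_restrict_iff' hIm).1 hqq'] with t ht hxy
    rw [ht (hI.uIcc_subset hx hy (uIoc_subset_uIcc hxy))]
  refine ⟨h.hasDeriv, fun x hx y hy => ?_, fun x hx y hy => ?_⟩
  · refine (h.integrable x hx y hy).congr_ae ?_
    exact (ae_restrict_iff' measurableSet_uIoc).2 (hae x hx y hy)
  · rw [h.integral_eq x hx y hy]
    exact intervalIntegral.integral_congr_ae (hae x hx y hy)

theorem linear (hu : IsSchrodingerSolution q k I u u') (hv : IsSchrodingerSolution q k I v v')
    (a b : ℂ) :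
    IsSchrodingerSolution q k I (fun x => a * u x + b * v x) (fun x => a * u' x + b * v' x) := by
  have hsplit : (fun t => ((q t - k ^ 2 : ℝ) : ℂ) * (a * u t + b * v t)) = fun t =>
      a * (((q t - k ^ 2 : ℝ) : ℂ) * u t) + b * (((q t - k ^ 2 : ℝ) : ℂ) * v t) := by
    ext t
    ring
  refine ⟨fun x hx => ((hu.hasDeriv x hx).const_mul a).add ((hv.hasDeriv x hx).const_mul b),
    fun x hx y hy => ?_, fun x hx y hy => ?_⟩
  · rw [hsplit]
    exact ((hu.integrable x hx y hy).const_mul a).add ((hv.integrable x hx y hy).const_mul b)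
  · rw [hsplit, intervalIntegral.integral_add ((hu.integrable x hx y hy).const_mul a)
      ((hv.integrable x hx y hy).const_mul b), intervalIntegral.integral_const_mul,
      intervalIntegral.integral_const_mul, ← hu.integral_eq x hx y hy, ← hv.integral_eq x hx y hy]
    ring

/-- The equation is invariant under the reflection `x ↦ b - x`. -/
theorem reflect (h : IsSchrodingerSolution q k univ u u') (b : ℝ) :
    IsSchrodingerSolution (fun x => q (b - x)) k univ (fun x => u (b - x))
      (fun x => -u' (b - x)) := by
  refine ⟨fun x _ => ?_, fun x _ y _ => ?_, fun x _ y _ => ?_⟩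
  · have h1 := (h.hasDeriv (b - x) (mem_univ _)).hasDerivAt univ_mem
    have h2 := h1.scomp x ((hasDerivAt_id x).const_sub b)
    have h3 : HasDerivAt (fun x => u (b - x)) (-u' (b - x)) x := by
      simpa [Function.comp_def] using h2
    exact h3.hasDerivWithinAt
  · have := (h.integrable (b - x) (mem_univ _) (b - y) (mem_univ _)).comp_sub_left b
    simpa using this
  · have h1 := h.integral_eq (b - y) (mem_univ _) (b - x) (mem_univ _)
    have h2 := intervalIntegral.integral_comp_sub_left (a := x) (b := y)
      (fun t => ((q t - k ^ 2 : ℝ) : ℂ) * u t) b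
    rw [h2, ← h1]
    ring

theorem neg_frequency (h : IsSchrodingerSolution q (-k) I u u') :
    IsSchrodingerSolution q k I u u' := by
  refine ⟨h.hasDeriv, fun x hx y hy => ?_, fun x hx y hy => ?_⟩
  · simpa only [neg_sq] using h.integrable x hx y hy
  · simpa only [neg_sq] using h.integral_eq x hx y hy

end IsSchrodingerSolution

/-! ### Pairing with a product of two kernels -/

/-- A kernel of the form `δ₀ + B` on `[0, ∞)` with `B` bounded and integrable, uniformly in
`x ∈ S`; the value at `s = 0` is the weight of the atom. -/
structure IsUnitKernel (S : Set ℝ) (B : ℝ × ℝ → ℝ) (C : ℝ) : Prop where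
  meas : Measurable B
  nonneg : 0 ≤ C
  zero : ∀ x ∈ S, B (x, 0) = 1
  bound : ∀ x ∈ S, ∀ s, 0 < s → |B (x, s)| ≤ C
  mass : ∀ x ∈ S, ∫⁻ s, ‖B (x, s)‖ₑ ∂jostMeasure ≤ ENNReal.ofReal C

namespace IsUnitKernel

variable {S : Set ℝ} {B B₁ B₂ : ℝ × ℝ → ℝ} {C C' : ℝ} {p : ℝ → ℝ}

theorem mono (h : IsUnitKernel S B C) (hC : C ≤ C') : IsUnitKernel S B C' :=
  ⟨h.meas, h.nonneg.trans hC, h.zero, fun x hx s hs => (h.bound x hx s hs).trans hC,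
    fun x hx => (h.mass x hx).trans (ENNReal.ofReal_le_ofReal hC)⟩

theorem comp_sub_left (h : IsUnitKernel (Ici 0) B C) (b : ℝ) :
    IsUnitKernel (Ioo 0 b) (fun y => B (b - y.1, y.2)) C :=
  have hm : ∀ x ∈ Ioo 0 b, b - x ∈ Ici 0 := fun x hx => sub_nonneg.2 hx.2.le
  ⟨h.meas.comp (by fun_prop), h.nonneg, fun x hx => h.zero _ (hm x hx),
    fun x hx => h.bound _ (hm x hx), fun x hx => h.mass _ (hm x hx)⟩

theorem integrable (h : IsUnitKernel S B C) {x : ℝ} (hx : x ∈ S) :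
    Integrable (fun s => B (x, s)) jostMeasure :=
  ⟨(h.meas.comp measurable_prodMk_left).aestronglyMeasurable,
    (h.mass x hx).trans_lt ENNReal.ofReal_lt_top⟩

/-- Integration against `δ₀ + B` differs from evaluation at `0` by the contribution of `B`. -/
theorem abs_integral_sub_le (h : IsUnitKernel S B C) {x : ℝ} (hx : x ∈ S) {g G : ℝ → ℝ}
    (hg : Measurable g) {D : ℝ} (hgD : ∀ s, |g s| ≤ D) (hG : IntegrableOn G (Ioi 0))
    (hgG : ∀ s, 0 < s → |g s| ≤ G s) :
    |∫ s, B (x, s) * g s ∂jostMeasure - g 0| ≤ C * ∫ s in Ioi 0, G s := by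
  have hI : Integrable (fun s => B (x, s) * g s) jostMeasure :=
    (h.integrable hx).mul_bdd hg.aestronglyMeasurable (Eventually.of_forall hgD)
  rw [integral_jostMeasure hI, h.zero x hx, one_mul, add_sub_cancel_left, ← Real.norm_eq_abs,
    ← integral_const_mul]
  refine norm_integral_le_of_norm_le (hG.const_mul C) ?_
  filter_upwards [ae_restrict_mem measurableSet_Ioi] with s hs
  rw [norm_mul]
  exact mul_le_mul (h.bound x hx s hs) (hgG s hs) (abs_nonneg _) h.nonneg

theorem abs_integral_sub_le_of_support (h : IsUnitKernel S B C) {x X : ℝ} (hx : x ∈ S)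
    (hX : 0 ≤ X) (hsupp : ∀ s, X < s → B (x, s) = 0) {g G : ℝ → ℝ}
    (hg : Measurable g) {D : ℝ} (hgD : ∀ s, |g s| ≤ D) (hG : Continuous G)
    (hgG : ∀ s, 0 < s → s ≤ X → |g s| ≤ G s) :
    |∫ s, B (x, s) * g s ∂jostMeasure - g 0| ≤ C * ∫ s in 0..X, G s := by
  have hI : Integrable (fun s => B (x, s) * g s) jostMeasure :=
    (h.integrable hx).mul_bdd hg.aestronglyMeasurable (Eventually.of_forall hgD)
  have hGi : IntegrableOn G (Ioc 0 X) := (hG.integrableOn_Icc).mono_set Ioc_subset_Icc_self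
  rw [integral_jostMeasure hI, h.zero x hx, one_mul, add_sub_cancel_left, ← Real.norm_eq_abs,
    intervalIntegral.integral_of_le hX, ← integral_const_mul,
    show Ioc 0 X = Ioi 0 ∩ Ioc 0 X from (inter_eq_self_of_subset_right Ioc_subset_Ioi_self).symm,
    ← setIntegral_indicator measurableSet_Ioc]
  refine norm_integral_le_of_norm_le
    ((show IntegrableOn (fun s => C * G s) (Ioc 0 X) volume from
      hGi.const_mul C).integrable_indicator measurableSet_Ioc).integrableOn ?_
  filter_upwards [ae_restrict_mem measurableSet_Ioi] with s hs
  by_cases hsX : s ≤ X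
  · rw [indicator_of_mem (show s ∈ Ioc 0 X from ⟨hs, hsX⟩), norm_mul]
    exact mul_le_mul (h.bound x hx s hs) (hgG s hs hsX) (abs_nonneg _) h.nonneg
  · rw [hsupp s (not_le.1 hsX), indicator_of_notMem fun h => hsX h.2]
    simp

theorem integrable_prod (h₁ : IsUnitKernel S B₁ C) (h₂ : IsUnitKernel S B₂ C) {x : ℝ}
    (hx : x ∈ S) : Integrable (fun z : ℝ × ℝ => B₁ (x, z.1) * B₂ (x, z.2))
      (jostMeasure.prod jostMeasure) :=
  (h₁.integrable hx).mul_prod (h₂.integrable hx)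

/-- The density `p(x) B₁(x, s) B₂(x, r)`. -/
theorem integrable_weight (h₁ : IsUnitKernel S B₁ C) (h₂ : IsUnitKernel S B₂ C)
    (hS : MeasurableSet S) (hp : IntegrableOn p S) (hpm : Measurable p) :
    Integrable (fun ω : ℝ × ℝ × ℝ => p ω.1 * (B₁ (ω.1, ω.2.1) * B₂ (ω.1, ω.2.2)))
      ((volume.restrict S).prod (jostMeasure.prod jostMeasure)) := by
  have hm₁ := h₁.meas
  have hm₂ := h₂.meas
  have hmeas : Measurable fun ω : ℝ × ℝ × ℝ => p ω.1 * (B₁ (ω.1, ω.2.1) * B₂ (ω.1, ω.2.2)) := by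
    fun_prop
  refine ⟨hmeas.aestronglyMeasurable, ?_⟩
  rw [HasFiniteIntegral, lintegral_prod _ hmeas.enorm.aemeasurable]
  calc _ ≤ ∫⁻ x in S, ‖p x‖ₑ * (ENNReal.ofReal C * ENNReal.ofReal C) := by
        refine setLIntegral_mono' hS fun x hx => ?_
        simp only [enorm_mul]
        rw [lintegral_const_mul _ (by fun_prop), lintegral_prod_mul
          (f := fun s => ‖B₁ (x, s)‖ₑ) (g := fun r => ‖B₂ (x, r)‖ₑ)
          (hm₁.comp measurable_prodMk_left).enorm.aemeasurable
          (hm₂.comp measurable_prodMk_left).enorm.aemeasurable]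
        exact mul_le_mul_right (mul_le_mul' (h₁.mass x hx) (h₂.mass x hx)) _
    _ = (∫⁻ x in S, ‖p x‖ₑ) * (ENNReal.ofReal C * ENNReal.ofReal C) :=
        lintegral_mul_const _ hpm.enorm
    _ < ⊤ := ENNReal.mul_lt_top hp.2 (ENNReal.mul_lt_top ENNReal.ofReal_lt_top
        ENNReal.ofReal_lt_top)

theorem integral_weight_mul (h₁ : IsUnitKernel S B₁ C) (h₂ : IsUnitKernel S B₂ C)
    (hS : MeasurableSet S) (hp : IntegrableOn p S) (hpm : Measurable p) {θ : ℝ × ℝ × ℝ → ℝ}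
    (hθ : Measurable θ) {D : ℝ} (hD : ∀ ω, |θ ω| ≤ D) :
    ∫ ω : ℝ × ℝ × ℝ, p ω.1 * (B₁ (ω.1, ω.2.1) * B₂ (ω.1, ω.2.2)) * θ ω
        ∂((volume.restrict S).prod (jostMeasure.prod jostMeasure)) =
      ∫ x in S, p x * ∫ s, B₁ (x, s) * ∫ r, B₂ (x, r) * θ (x, s, r) ∂jostMeasure
        ∂jostMeasure := by
  rw [integral_prod _ ((integrable_weight h₁ h₂ hS hp hpm).mul_bdd (c := D)
    hθ.aestronglyMeasurable (Eventually.of_forall hD))]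
  refine setIntegral_congr_fun hS fun x hx => ?_
  simp only [mul_assoc]
  rw [integral_const_mul, integral_prod]
  · simp only [integral_const_mul]
  · simp only [← mul_assoc]
    exact (integrable_prod h₁ h₂ hx).mul_bdd (c := D)
      (hθ.comp measurable_prodMk_left).aestronglyMeasurable (Eventually.of_forall fun z => hD _)

theorem integral_weight_mul_exp (h₁ : IsUnitKernel S B₁ C) (h₂ : IsUnitKernel S B₂ C)
    (hS : MeasurableSet S) (hp : IntegrableOn p S) (hpm : Measurable p) {a : ℝ → ℝ}
    (ha : Measurable a) (σ τ k : ℝ) :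
    ∫ ω : ℝ × ℝ × ℝ, ((p ω.1 * (B₁ (ω.1, ω.2.1) * B₂ (ω.1, ω.2.2)) : ℝ) : ℂ) *
        Complex.exp (k * ((a ω.1 + 2 * σ * ω.2.1 + 2 * τ * ω.2.2 : ℝ) : ℂ) * Complex.I)
        ∂((volume.restrict S).prod (jostMeasure.prod jostMeasure)) =
      ∫ x in S, (p x : ℂ) * (Complex.exp (k * a x * Complex.I) *
        (jostTransform B₁ (σ * k) x * jostTransform B₂ (τ * k) x)) := by
  rw [integral_prod _ ((integrable_weight h₁ h₂ hS hp hpm).ofReal.mul_bdd (c := 1)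
    (Measurable.aestronglyMeasurable (by fun_prop)) (Eventually.of_forall fun ω => by
      rw [← Complex.ofReal_mul, Complex.norm_exp_ofReal_mul_I]))]
  refine integral_congr_ae (Eventually.of_forall fun x => ?_)
  simp only [jostTransform]
  rw [← integral_prod_mul (μ := jostMeasure) (ν := jostMeasure)
    (fun s : ℝ => (B₁ (x, s) : ℂ) * Complex.exp (2 * ((σ * k : ℝ) : ℂ) * s * Complex.I))
    (fun r : ℝ => (B₂ (x, r) : ℂ) * Complex.exp (2 * ((τ * k : ℝ) : ℂ) * r * Complex.I)),
    ← integral_const_mul, ← integral_const_mul]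
  refine integral_congr_ae (Eventually.of_forall fun z => ?_)
  simp only
  have hE : Complex.exp (k * ((a x + 2 * σ * z.1 + 2 * τ * z.2 : ℝ) : ℂ) * Complex.I) =
      Complex.exp (k * a x * Complex.I) *
        (Complex.exp (2 * ((σ * k : ℝ) : ℂ) * z.1 * Complex.I) *
          Complex.exp (2 * ((τ * k : ℝ) : ℂ) * z.2 * Complex.I)) := by
    rw [← Complex.exp_add, ← Complex.exp_add]
    congr 1
    push_cast
    ring
  rw [hE]
  push_cast
  ring

theorem stronglyMeasurable_integral_mul (h₁ : IsUnitKernel S B₁ C) (h₂ : IsUnitKernel S B₂ C)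
    {θ : ℝ × ℝ × ℝ → ℝ} (hθ : Measurable θ) :
    StronglyMeasurable fun x =>
      ∫ s, B₁ (x, s) * ∫ r, B₂ (x, r) * θ (x, s, r) ∂jostMeasure ∂jostMeasure := by
  have hm₁ := h₁.meas
  have hm₂ := h₂.meas
  have hin : StronglyMeasurable fun y : ℝ × ℝ =>
      ∫ r, B₂ (y.1, r) * θ (y.1, y.2, r) ∂jostMeasure :=
    StronglyMeasurable.integral_prod_right (ν := jostMeasure)
      (f := fun (y : ℝ × ℝ) r => B₂ (y.1, r) * θ (y.1, y.2, r))
      (Measurable.stronglyMeasurable (by fun_prop))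
  exact StronglyMeasurable.integral_prod_right (ν := jostMeasure)
    (f := fun x s => B₁ (x, s) * ∫ r, B₂ (x, r) * θ (x, s, r) ∂jostMeasure)
    (hm₁.stronglyMeasurable.mul hin)

end IsUnitKernel

/-! ### Products of Jost solutions and of regular waves -/

theorem exists_measurable_sign {p : ℝ → ℝ} (hp : Measurable p) :
    ∃ σ : ℝ → ℝ, Measurable σ ∧ (∀ x, p x * σ x = |p x|) ∧ ∀ x, |σ x| ≤ 1 := by
  refine ⟨fun x => if 0 ≤ p x then 1 else -1,
    Measurable.ite (measurableSet_le measurable_const hp) measurable_const measurable_const,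
    fun x => ?_, fun x => ?_⟩
  · by_cases h : 0 ≤ p x
    · simp [h, abs_of_nonneg]
    · simp [h, abs_of_neg (not_le.1 h)]
  · by_cases h : 0 ≤ p x <;> simp [h]

theorem integrableOn_exp_neg_mul {L : ℝ} (hL : 0 < L) :
    IntegrableOn (fun s => Real.exp (-(L * s))) (Ioi 0) := by
  simpa only [neg_mul] using integrableOn_exp_mul_Ioi (neg_lt_zero.2 hL) 0

theorem integral_exp_neg_mul {L : ℝ} (hL : 0 < L) :
    ∫ s in Ioi (0 : ℝ), Real.exp (-(L * s)) = 1 / L := by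
  have := integral_exp_mul_Ioi (neg_lt_zero.2 hL) 0
  simpa only [neg_mul, mul_zero, neg_zero, Real.exp_zero, neg_div_neg_eq] using this

namespace IsUnitKernel

variable {B₁ B₂ : ℝ × ℝ → ℝ} {C : ℝ} {p : ℝ → ℝ}

/-- Completeness of the products `e^{2ikx} (1 + ∫ B₁ e^{2iks} ds) (1 + ∫ B₂ e^{2iks} ds)` on the
half line. -/
theorem ae_eq_zero_of_integral_jost (h₁ : IsUnitKernel (Ioi 0) B₁ C)
    (h₂ : IsUnitKernel (Ioi 0) B₂ C) (hp : IntegrableOn p (Ioi 0)) (hpm : Measurable p)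
    (h : ∀ k : ℝ, 0 < k → ∫ x in Ioi (0 : ℝ), (p x : ℂ) * (Complex.exp (k * (2 * x : ℝ) *
      Complex.I) * (jostTransform B₁ k x * jostTransform B₂ k x)) = 0) :
    p =ᵐ[volume.restrict (Ioi 0)] 0 := by
  obtain ⟨σ, hσm, hσ, hσ1⟩ := exists_measurable_sign hpm
  have hC := h₁.nonneg
  obtain ⟨L, hL, hCL⟩ : ∃ L : ℝ, 0 < L ∧ C / L ≤ 1 / 8 := by
    refine ⟨8 * C + 1, by linarith, ?_⟩
    rw [div_le_iff₀ (by linarith)]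
    linarith
  -- the test function, in the variable `z = x + s + r`
  set η : ℝ → ℝ := fun z => if 0 < z then σ z * Real.exp (-(L * z)) else 0 with hη
  have hηm : Measurable η := Measurable.ite measurableSet_Ioi (by fun_prop) measurable_const
  have hηle : ∀ z, 0 < z → |η z| ≤ Real.exp (-(L * z)) := by
    intro z hz
    simp only [hη, if_pos hz, abs_mul, Real.abs_exp]
    exact mul_le_of_le_one_left (Real.exp_pos _).le (hσ1 z)
  have hη1 : ∀ z, |η z| ≤ 1 := by
    intro z
    by_cases hz : 0 < z
    · exact (hηle z hz).trans (Real.exp_le_one_iff.2 (by nlinarith))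
    · simp [hη, hz]
  have hvanish := sum_integral_comp_eq_zero_of_fourier (ι := Unit)
    (μ := (volume.restrict (Ioi 0)).prod (jostMeasure.prod jostMeasure))
    (w := fun _ ω => p ω.1 * (B₁ (ω.1, ω.2.1) * B₂ (ω.1, ω.2.2)))
    (fun _ => integrable_weight h₁ h₂ measurableSet_Ioi hp hpm)
    (Z := fun _ ω => 2 * ω.1 + 2 * 1 * ω.2.1 + 2 * 1 * ω.2.2) (fun _ => by fun_prop)
    (fun k hk => by
      rw [Fintype.sum_unique, integral_weight_mul_exp h₁ h₂ measurableSet_Ioi hp hpm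
        (a := fun x => 2 * x) (by fun_prop) 1 1 k]
      simpa only [one_mul] using h k hk)
    (η := fun z => η (z / 2)) (hηm.comp (by fun_prop)) (fun z => hη1 _)
  have hθm : Measurable fun ω : ℝ × ℝ × ℝ =>
      η ((2 * ω.1 + 2 * 1 * ω.2.1 + 2 * 1 * ω.2.2) / 2) := hηm.comp (by fun_prop)
  rw [Fintype.sum_unique, integral_weight_mul h₁ h₂ measurableSet_Ioi hp hpm hθm
    (fun ω => hη1 _)] at hvanish
  refine ae_eq_zero_of_integral_mul_eq_zero hp hσ hσ1
    (stronglyMeasurable_integral_mul h₁ h₂ hθm).aestronglyMeasurable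
    (e := fun x => Real.exp (-(L * x))) (by fun_prop) (fun x => Real.exp_pos _) (D := 1) ?_ ?_
    hvanish
  · filter_upwards [ae_restrict_mem measurableSet_Ioi] with x hx
    have : 0 < x := hx
    exact Real.exp_le_one_iff.2 (by nlinarith)
  · filter_upwards [ae_restrict_mem measurableSet_Ioi] with x hx
    have hx0 : 0 < x := hx
    -- integration against the second kernel
    set A : ℝ → ℝ := fun u => ∫ r, B₂ (x, r) * η (u + r) ∂jostMeasure with hA
    have hAm : Measurable A := by
      have := h₂.meas
      exact (StronglyMeasurable.integral_prod_right (ν := jostMeasure)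
        (f := fun u r => B₂ (x, r) * η (u + r))
        (Measurable.stronglyMeasurable (by fun_prop))).measurable
    have hbd : ∀ u, 0 < u → |A u - η u| ≤ C / L * Real.exp (-(L * u)) := by
      intro u hu
      have := h₂.abs_integral_sub_le hx (g := fun r => η (u + r)) (by fun_prop)
        (fun s => hη1 _) ((integrableOn_exp_neg_mul hL).const_mul (Real.exp (-(L * u))))
        (fun s hs => (hηle _ (by linarith)).trans (le_of_eq (by rw [← Real.exp_add]; ring_nf)))
      rw [integral_const_mul, integral_exp_neg_mul hL, add_zero] at this
      refine this.trans (le_of_eq ?_)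
      ring
    have hA2 : ∀ u, 0 < u → |A u| ≤ 9 / 8 * Real.exp (-(L * u)) := by
      intro u hu
      have h1 := hbd u hu
      have h2 := hηle u hu
      have h3 := abs_add_le (A u - η u) (η u)
      rw [sub_add_cancel] at h3
      nlinarith [Real.exp_pos (-(L * u))]
    -- `A` is only controlled for positive arguments
    have hAclip : ∀ s : ℝ, |A (max (x + s) x)| ≤ 9 / 8 := by
      intro s
      have : 0 < max (x + s) x := lt_of_lt_of_le hx0 (le_max_right _ _)
      refine (hA2 _ this).trans ?_
      have : Real.exp (-(L * max (x + s) x)) ≤ 1 := Real.exp_le_one_iff.2 (by nlinarith)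
      linarith
    have hJ : ∫ s, B₁ (x, s) * ∫ r, B₂ (x, r) * η ((2 * x + 2 * 1 * s + 2 * 1 * r) / 2)
        ∂jostMeasure ∂jostMeasure = ∫ s, B₁ (x, s) * A (max (x + s) x) ∂jostMeasure := by
      refine integral_congr_ae (ae_jostMeasure_nonneg.mono fun s hs => ?_)
      simp only [hA]
      rw [max_eq_left (by linarith)]
      congr 1
      refine integral_congr_ae (Eventually.of_forall fun r => ?_)
      simp only
      congr 2
      ring
    have hout := h₁.abs_integral_sub_le hx (g := fun s => A (max (x + s) x)) (by fun_prop)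
      hAclip ((integrableOn_exp_neg_mul hL).const_mul (9 / 8 * Real.exp (-(L * x))))
      (fun s hs => by
        rw [max_eq_left (by linarith)]
        refine (hA2 _ (by linarith)).trans (le_of_eq ?_)
        rw [mul_assoc, ← Real.exp_add]
        ring_nf)
    rw [integral_const_mul, integral_exp_neg_mul hL, add_zero, max_self] at hout
    rw [hJ]
    have h1 := hbd x hx0
    have h2 : η x = σ x * Real.exp (-(L * x)) := by simp only [hη, if_pos hx0]
    rw [← h2]
    have h3 := abs_add_le ((∫ s, B₁ (x, s) * A (max (x + s) x) ∂jostMeasure) - A x) (A x - η x)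
    rw [sub_add_sub_cancel] at h3
    have h4 : C * (9 / 8 * Real.exp (-(L * x)) * (1 / L)) =
        C / L * (9 / 8 * Real.exp (-(L * x))) := by ring
    rw [h4] at hout
    have hE := Real.exp_pos (-(L * x))
    have h5 := mul_le_mul_of_nonneg_right hCL hE.le
    have h6 : C / L * (9 / 8 * Real.exp (-(L * x))) = 9 / 8 * (C / L * Real.exp (-(L * x))) := by
      ring
    linarith

theorem integrableOn_mul_jostTransform {S : Set ℝ} (h₁ : IsUnitKernel S B₁ C)
    (h₂ : IsUnitKernel S B₂ C) (hS : MeasurableSet S) (hp : IntegrableOn p S) (a k l : ℝ) :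
    IntegrableOn (fun x => (p x : ℂ) * (Complex.exp (a * x * Complex.I) *
      (jostTransform B₁ k x * jostTransform B₂ l x))) S := by
  refine hp.ofReal.mul_bdd (c := 1 * (C * C)) ?_ ?_
  · exact (Measurable.aestronglyMeasurable (by fun_prop)).mul
      ((stronglyMeasurable_jostTransform h₁.meas k).aestronglyMeasurable.mul
        (stronglyMeasurable_jostTransform h₂.meas l).aestronglyMeasurable)
  · filter_upwards [ae_restrict_mem hS] with x hx
    rw [norm_mul, norm_mul, norm_exp_mul]
    refine mul_le_mul_of_nonneg_left ?_ zero_le_one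
    exact mul_le_mul (norm_jostTransform_le h₁.nonneg (h₁.mass x hx) k)
      (norm_jostTransform_le h₂.nonneg (h₂.mass x hx) l) (norm_nonneg _) h₁.nonneg

end IsUnitKernel

/-- The solution `e^{ikx} (1 + ∫ B(x, s) e^{-2iks} ds)` with unit value and derivative `ik` at `0`,
for a kernel that lives on `s ≤ x`. -/
noncomputable def regularWave (B : ℝ × ℝ → ℝ) (k x : ℝ) : ℂ :=
  Complex.exp (k * x * Complex.I) * jostTransform B (-k) x

theorem integral_exp_growth_le {L x : ℝ} (hL : 0 < L) :
    ∫ s in (0 : ℝ)..x, (Real.exp (L * (x - s)) + Real.exp (L * s)) ≤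
      2 * (Real.exp (L * x) / L) := by
  have h1 : ∫ s in (0 : ℝ)..x, Real.exp (L * s) = (Real.exp (L * x) - 1) / L := by
    rw [intervalIntegral.integral_comp_mul_left Real.exp hL.ne', integral_exp, mul_zero,
      Real.exp_zero, smul_eq_mul]
    ring
  have h2 : ∫ s in (0 : ℝ)..x, Real.exp (L * (x - s)) = ∫ s in (0 : ℝ)..x, Real.exp (L * s) := by
    rw [intervalIntegral.integral_comp_sub_left (fun s => Real.exp (L * s)), sub_self, sub_zero]
  rw [intervalIntegral.integral_add (Continuous.intervalIntegrable (by fun_prop) _ _)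
    (Continuous.intervalIntegrable (by fun_prop) _ _), h2, h1]
  have h3 : (Real.exp (L * x) - 1) / L ≤ Real.exp (L * x) / L :=
    div_le_div_of_nonneg_right (by linarith) hL.le
  linarith

namespace IsUnitKernel

variable {B₁ B₂ : ℝ × ℝ → ℝ} {C : ℝ} {p : ℝ → ℝ}

/-- The Fourier variable can be eliminated from an orthogonality relation between `p` and the
products of regular waves: all even test functions in the phases `x - s - r` and `s - r` are
admissible. -/
theorem integral_even_eq_zero {b ε : ℝ} (h₁ : IsUnitKernel (Ioo 0 b) B₁ C)
    (h₂ : IsUnitKernel (Ioo 0 b) B₂ C) (hp : IntegrableOn p (Ioo 0 b)) (hpm : Measurable p)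
    (h : ∀ k : ℝ, 0 < k → ∫ x in Ioo 0 b, (p x : ℂ) *
      (regularWave B₁ k x * regularWave B₂ k x + regularWave B₁ (-k) x * regularWave B₂ (-k) x +
        ε * (regularWave B₁ k x * regularWave B₂ (-k) x +
          regularWave B₁ (-k) x * regularWave B₂ k x)) = 0)
    {η : ℝ → ℝ} (hη : Measurable η) (heven : ∀ z, η (-z) = η z) {D : ℝ} (hD : ∀ z, |η z| ≤ D) :
    ∫ ω : ℝ × ℝ × ℝ, p ω.1 * (B₁ (ω.1, ω.2.1) * B₂ (ω.1, ω.2.2)) *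
        (η (ω.1 - ω.2.1 - ω.2.2) + ε * η (ω.2.1 - ω.2.2))
        ∂((volume.restrict (Ioo 0 b)).prod (jostMeasure.prod jostMeasure)) = 0 := by
  -- `i` selects the signs of the two frequencies; `c i` is the coefficient of that product
  set t : Bool → ℝ := fun i => if i then 1 else -1 with ht
  set c : Bool × Bool → ℝ := fun i => if i.1 = i.2 then 1 else ε with hc
  have hpi : ∀ i, IntegrableOn (fun x => c i * p x) (Ioo 0 b) := fun i => hp.const_mul _
  have hpmi : ∀ i, Measurable fun x => c i * p x := fun i => hpm.const_mul _
  have hwi : ∀ i, Integrable (fun ω : ℝ × ℝ × ℝ =>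
      c i * p ω.1 * (B₁ (ω.1, ω.2.1) * B₂ (ω.1, ω.2.2)))
      ((volume.restrict (Ioo 0 b)).prod (jostMeasure.prod jostMeasure)) := fun i =>
    integrable_weight h₁ h₂ measurableSet_Ioo (hpi i) (hpmi i)
  have hZm : ∀ i : Bool × Bool, Measurable fun ω : ℝ × ℝ × ℝ =>
      (t i.1 + t i.2) * ω.1 + 2 * (-t i.1) * ω.2.1 + 2 * (-t i.2) * ω.2.2 := fun i => by fun_prop
  have hvanish := sum_integral_comp_eq_zero_of_fourier (ι := Bool × Bool) hwi hZm
    (fun k hk => by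
      rw [← h k hk]
      have hterm : ∀ i : Bool × Bool, ∫ ω : ℝ × ℝ × ℝ,
          ((c i * p ω.1 * (B₁ (ω.1, ω.2.1) * B₂ (ω.1, ω.2.2)) : ℝ) : ℂ) *
          Complex.exp (k * (((t i.1 + t i.2) * ω.1 + 2 * (-t i.1) * ω.2.1 +
            2 * (-t i.2) * ω.2.2 : ℝ) : ℂ) * Complex.I)
          ∂((volume.restrict (Ioo 0 b)).prod (jostMeasure.prod jostMeasure)) =
          ∫ x in Ioo 0 b, ((c i * p x : ℝ) : ℂ) *
            (Complex.exp (((k * (t i.1 + t i.2) : ℝ) : ℂ) * x * Complex.I) *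
            (jostTransform B₁ (-t i.1 * k) x * jostTransform B₂ (-t i.2 * k) x)) := by
        intro i
        rw [integral_weight_mul_exp h₁ h₂ measurableSet_Ioo (hpi i) (hpmi i)
          (a := fun x => (t i.1 + t i.2) * x) (by fun_prop) (-t i.1) (-t i.2) k]
        refine integral_congr_ae (Eventually.of_forall fun x => ?_)
        simp only
        congr 3
        push_cast
        ring
      rw [Finset.sum_congr rfl fun i _ => hterm i, ← integral_finsetSum _ fun i _ =>
        integrableOn_mul_jostTransform h₁ h₂ measurableSet_Ioo (hpi i) _ _ _]
      refine integral_congr_ae (Eventually.of_forall fun x => ?_)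
      have he1 : ∀ a : ℂ,
          Complex.exp (a * x * Complex.I) * Complex.exp (-a * x * Complex.I) = 1 := by
        intro a
        rw [← Complex.exp_add, ← Complex.exp_zero]
        congr 1
        ring
      have he2 : ∀ a : ℂ, Complex.exp ((a * (1 + 1)) * x * Complex.I) =
          Complex.exp (a * x * Complex.I) * Complex.exp (a * x * Complex.I) := by
        intro a
        rw [← Complex.exp_add]
        congr 1
        ring
      have he3 : Complex.exp ((k * (-1 + -1) : ℂ) * x * Complex.I) =
          Complex.exp (-k * x * Complex.I) * Complex.exp (-k * x * Complex.I) := by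
        rw [← Complex.exp_add]
        congr 1
        ring
      simp only [Fintype.sum_prod_type, Fintype.sum_bool, ht, hc, regularWave, if_true,
        Bool.false_eq_true, if_false, reduceCtorEq]
      push_cast
      simp only [he2, he3, neg_neg, one_mul, neg_mul, neg_add_cancel, add_neg_cancel, mul_zero,
        zero_mul, Complex.exp_zero]
      have := he1 k
      simp only [neg_mul] at this
      linear_combination (-(ε * p x : ℂ) * (jostTransform B₁ (-k) x * jostTransform B₂ k x +
        jostTransform B₁ k x * jostTransform B₂ (-k) x)) * this)
    (η := fun z => η (z / 2)) (hη.comp (by fun_prop)) (fun z => hD _)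
  have hηZ : ∀ i : Bool × Bool, Measurable fun ω : ℝ × ℝ × ℝ =>
      η (((t i.1 + t i.2) * ω.1 + 2 * (-t i.1) * ω.2.1 + 2 * (-t i.2) * ω.2.2) / 2) := fun i =>
    hη.comp ((hZm i).div_const 2)
  rw [← integral_finsetSum _ fun i _ => (hwi i).mul_bdd (c := D)
    (hηZ i).aestronglyMeasurable (Eventually.of_forall fun ω => hD _)] at hvanish
  have h2 : ∀ ω : ℝ × ℝ × ℝ, ∑ i : Bool × Bool,
      c i * p ω.1 * (B₁ (ω.1, ω.2.1) * B₂ (ω.1, ω.2.2)) *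
        η (((t i.1 + t i.2) * ω.1 + 2 * (-t i.1) * ω.2.1 + 2 * (-t i.2) * ω.2.2) / 2) =
      2 * (p ω.1 * (B₁ (ω.1, ω.2.1) * B₂ (ω.1, ω.2.2)) *
        (η (ω.1 - ω.2.1 - ω.2.2) + ε * η (ω.2.1 - ω.2.2))) := by
    intro ω
    simp only [Fintype.sum_prod_type, Fintype.sum_bool, ht, hc, if_true,
        Bool.false_eq_true, if_false, reduceCtorEq]
    rw [show ((1 + 1) * ω.1 + 2 * -1 * ω.2.1 + 2 * -1 * ω.2.2) / 2 = ω.1 - ω.2.1 - ω.2.2 by ring,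
      show ((1 + -1) * ω.1 + 2 * -1 * ω.2.1 + 2 * - -1 * ω.2.2) / 2 = -(ω.2.1 - ω.2.2) by ring,
      show ((-1 + 1) * ω.1 + 2 * - -1 * ω.2.1 + 2 * -1 * ω.2.2) / 2 = ω.2.1 - ω.2.2 by ring,
      show ((-1 + -1) * ω.1 + 2 * - -1 * ω.2.1 + 2 * - -1 * ω.2.2) / 2 =
        -(ω.1 - ω.2.1 - ω.2.2) by ring, heven, heven]
    ring
  simp only [h2, integral_const_mul] at hvanish
  simpa using hvanish

end IsUnitKernel

namespace IsUnitKernel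

variable {B₁ B₂ : ℝ × ℝ → ℝ} {C : ℝ} {p : ℝ → ℝ}

/-- Completeness on `(0, b)` of the even part (`ε = 1`) and of the odd part (`ε = -1`) of the
products of regular waves. -/
theorem ae_eq_zero_of_integral_regular {b ε : ℝ} (hb : 0 < b) (hε : |ε| ≤ 1)
    (h₁ : IsUnitKernel (Ioo 0 b) B₁ C) (h₂ : IsUnitKernel (Ioo 0 b) B₂ C)
    (hs₁ : ∀ x ∈ Ioo 0 b, ∀ s, x < s → B₁ (x, s) = 0)
    (hs₂ : ∀ x ∈ Ioo 0 b, ∀ s, x < s → B₂ (x, s) = 0)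
    (hp : IntegrableOn p (Ioo 0 b)) (hpm : Measurable p)
    (h : ∀ k : ℝ, 0 < k → ∫ x in Ioo 0 b, (p x : ℂ) *
      (regularWave B₁ k x * regularWave B₂ k x + regularWave B₁ (-k) x * regularWave B₂ (-k) x +
        ε * (regularWave B₁ k x * regularWave B₂ (-k) x +
          regularWave B₁ (-k) x * regularWave B₂ k x)) = 0) :
    p =ᵐ[volume.restrict (Ioo 0 b)] 0 := by
  obtain ⟨σ, hσm, hσ, hσ1⟩ := exists_measurable_sign hpm
  have hC := h₁.nonneg
  -- `2C (3 + 2Cb) / L` will be the total relative error of the pairing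
  obtain ⟨L, hL, hCL⟩ : ∃ L : ℝ, 0 < L ∧ 2 * C * (3 + 2 * C * b) / L ≤ 1 / 2 := by
    have : 0 ≤ 2 * C * (3 + 2 * C * b) := by positivity
    refine ⟨2 * (2 * C * (3 + 2 * C * b)) + 1, by linarith, ?_⟩
    rw [div_le_iff₀ (by linarith)]
    linarith
  -- The value `0` at `z = 0` removes the contribution of the atoms to the phase `s - r`.
  set η : ℝ → ℝ := fun z => if 0 < |z| ∧ |z| < b then σ |z| * Real.exp (L * |z|) else 0 with hη
  have hηm : Measurable η := by
    have ha : Measurable fun z : ℝ => |z| := by fun_prop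
    exact Measurable.ite ((measurableSet_lt measurable_const ha).inter
      (measurableSet_lt ha measurable_const)) (by fun_prop) measurable_const
  have hηle : ∀ z, |η z| ≤ Real.exp (L * |z|) := by
    intro z
    by_cases hz : 0 < |z| ∧ |z| < b
    · simp only [hη, if_pos hz, abs_mul, Real.abs_exp]
      exact mul_le_of_le_one_left (Real.exp_pos _).le (hσ1 _)
    · simp only [hη, if_neg hz, abs_zero]
      exact (Real.exp_pos _).le
  have hηD : ∀ z, |η z| ≤ Real.exp (L * b) := by
    intro z
    by_cases hz : 0 < |z| ∧ |z| < b
    · exact (hηle z).trans (Real.exp_le_exp.2 (mul_le_mul_of_nonneg_left hz.2.le hL.le))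
    · simp only [hη, if_neg hz, abs_zero]
      exact (Real.exp_pos _).le
  have hvanish := integral_even_eq_zero h₁ h₂ hp hpm h hηm (fun z => by simp only [hη, abs_neg]) hηD
  have hθm : Measurable fun ω : ℝ × ℝ × ℝ =>
      η (ω.1 - ω.2.1 - ω.2.2) + ε * η (ω.2.1 - ω.2.2) := by fun_prop
  rw [integral_weight_mul h₁ h₂ measurableSet_Ioo hp hpm hθm
    (D := Real.exp (L * b) + Real.exp (L * b)) (fun ω => by
      refine (abs_add_le _ _).trans (add_le_add (hηD _) ?_)
      rw [abs_mul]
      exact (mul_le_of_le_one_left (abs_nonneg _) hε).trans (hηD _))] at hvanish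
  refine ae_eq_zero_of_integral_mul_eq_zero hp hσ hσ1
    (stronglyMeasurable_integral_mul h₁ h₂ hθm).aestronglyMeasurable
    (e := fun x => Real.exp (L * x)) (by fun_prop) (fun x => Real.exp_pos _)
    (D := Real.exp (L * b)) ?_ ?_ hvanish
  · filter_upwards [ae_restrict_mem measurableSet_Ioo] with x hx
    exact Real.exp_le_exp.2 (mul_le_mul_of_nonneg_left hx.2.le hL.le)
  · filter_upwards [ae_restrict_mem measurableSet_Ioo] with x hx
    set A : ℝ → ℝ := fun u => ∫ r, B₂ (x, r) * η (u - r) ∂jostMeasure with hA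
    have hAm : Measurable A := by
      have := h₂.meas
      exact (StronglyMeasurable.integral_prod_right (ν := jostMeasure)
        (f := fun u r => B₂ (x, r) * η (u - r))
        (Measurable.stronglyMeasurable (by fun_prop))).measurable
    set R : ℝ := 2 * C * (Real.exp (L * x) / L) with hR
    have hR0 : 0 ≤ R := by positivity
    have hη_le_add : ∀ u r, 0 ≤ u → u ≤ x → 0 ≤ r → r ≤ x →
        |η (u - r)| ≤ Real.exp (L * (x - r)) + Real.exp (L * r) := by
      intro u r hu hux hr hrx
      refine (hηle _).trans ?_
      rcases le_total u r with hur | hur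
      · rw [abs_of_nonpos (by linarith)]
        have : Real.exp (L * -(u - r)) ≤ Real.exp (L * r) :=
          Real.exp_le_exp.2 (mul_le_mul_of_nonneg_left (by linarith) hL.le)
        have := Real.exp_pos (L * (x - r))
        linarith
      · rw [abs_of_nonneg (by linarith)]
        have : Real.exp (L * (u - r)) ≤ Real.exp (L * (x - r)) :=
          Real.exp_le_exp.2 (mul_le_mul_of_nonneg_left (by linarith) hL.le)
        have := Real.exp_pos (L * r)
        linarith
    have hbd : ∀ u, 0 ≤ u → u ≤ x → |A u - η u| ≤ R := by
      intro u hu hux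
      have := h₂.abs_integral_sub_le_of_support hx hx.1.le (hs₂ x hx) (g := fun r => η (u - r))
        (G := fun r => Real.exp (L * (x - r)) + Real.exp (L * r))
        (by fun_prop) (fun s => hηD _) (by fun_prop)
        (fun s hs hsx => hη_le_add u s hu hux hs.le hsx)
      rw [sub_zero] at this
      refine this.trans ((mul_le_mul_of_nonneg_left (integral_exp_growth_le hL) hC).trans
        (le_of_eq ?_))
      rw [hR]
      ring
    have hA2 : ∀ u, 0 ≤ u → u ≤ x → |A u| ≤ Real.exp (L * u) + R := by
      intro u hu hux
      have h1 := hbd u hu hux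
      have h2 := hηle u
      rw [abs_of_nonneg hu] at h2
      have h3 := abs_add_le (A u - η u) (η u)
      rw [sub_add_cancel] at h3
      linarith
    have hAall : ∀ u, |A u| ≤ C * Real.exp (L * b) := by
      intro u
      have h1 := h₂.mass x hx
      rw [← ofReal_integral_norm_eq_lintegral_enorm (h₂.integrable hx),
        ENNReal.ofReal_le_ofReal_iff hC] at h1
      have h2 : |A u| ≤ ∫ r, ‖B₂ (x, r)‖ * Real.exp (L * b) ∂jostMeasure := by
        simp only [hA]
        rw [← Real.norm_eq_abs]
        refine norm_integral_le_of_norm_le ((h₂.integrable hx).norm.mul_const _)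
          (Eventually.of_forall fun r => ?_)
        rw [norm_mul]
        exact mul_le_mul_of_nonneg_left (hηD _) (norm_nonneg _)
      rw [integral_mul_const] at h2
      exact h2.trans (mul_le_mul_of_nonneg_right h1 (Real.exp_pos _).le)
    have hJ : ∫ s, B₁ (x, s) * ∫ r, B₂ (x, r) * (η (x - s - r) + ε * η (s - r))
        ∂jostMeasure ∂jostMeasure = ∫ s, B₁ (x, s) * (A (x - s) + ε * A s) ∂jostMeasure := by
      refine integral_congr_ae (Eventually.of_forall fun s => ?_)
      simp only [hA]
      have hI : ∀ u, Integrable (fun r => B₂ (x, r) * η (u - r)) jostMeasure := fun u =>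
        (h₂.integrable hx).mul_bdd (c := Real.exp (L * b))
          (hηm.comp (measurable_const.sub measurable_id : Measurable fun r : ℝ => u - r)
            ).aestronglyMeasurable (Eventually.of_forall fun r => hηD _)
      rw [← integral_const_mul ε, ← integral_add (hI _) ((hI _).const_mul _)]
      congr 1
      refine integral_congr_ae (Eventually.of_forall fun r => ?_)
      simp only
      ring
    have hsum : ∀ u v : ℝ, |u + ε * v| ≤ |u| + |v| := by
      intro u v
      refine (abs_add_le _ _).trans (add_le_add le_rfl ?_)
      rw [abs_mul]
      exact mul_le_of_le_one_left (abs_nonneg _) hε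
    have hout := h₁.abs_integral_sub_le_of_support hx hx.1.le (hs₁ x hx)
      (g := fun s => A (x - s) + ε * A s)
      (G := fun s => (Real.exp (L * (x - s)) + Real.exp (L * s)) + 2 * R) (by fun_prop)
      (D := C * Real.exp (L * b) + C * Real.exp (L * b))
      (fun s => (hsum _ _).trans (add_le_add (hAall _) (hAall _))) (by fun_prop)
      (fun s hs hsx => by
        have h1 := hA2 (x - s) (by linarith) (by linarith)
        have h2 := hA2 s hs.le hsx
        have h3 := hsum (A (x - s)) (A s)
        linarith)
    have hGle : ∫ s in (0 : ℝ)..x, ((Real.exp (L * (x - s)) + Real.exp (L * s)) + 2 * R) ≤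
        2 * (Real.exp (L * x) / L) + 2 * R * b := by
      rw [intervalIntegral.integral_add (Continuous.intervalIntegrable (by fun_prop) _ _)
        (Continuous.intervalIntegrable (by fun_prop) _ _), intervalIntegral.integral_const,
        smul_eq_mul, sub_zero]
      have h1 := integral_exp_growth_le (x := x) hL
      have h2 := mul_le_mul_of_nonneg_right hx.2.le (by positivity : 0 ≤ 2 * R)
      linarith
    have hout2 := hout.trans (mul_le_mul_of_nonneg_left hGle hC)
    rw [sub_zero] at hout2
    rw [hJ]
    have hηx : η x = σ x * Real.exp (L * x) := by
      have hxa : |x| = x := abs_of_pos hx.1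
      simp only [hη, hxa]
      rw [if_pos ⟨hx.1, hx.2⟩]
    have hη0 : η 0 = 0 := by simp [hη]
    rw [← hηx]
    have h1 := hbd x hx.1.le le_rfl
    have h2 := hbd 0 le_rfl hx.1.le
    rw [hη0, sub_zero] at h2
    have h3 := hsum (A x - η x) (A 0)
    have h4 := abs_add_le ((∫ s, B₁ (x, s) * (A (x - s) + ε * A s) ∂jostMeasure) -
      (A x + ε * A 0)) ((A x - η x) + ε * A 0)
    have h5 : (∫ s, B₁ (x, s) * (A (x - s) + ε * A s) ∂jostMeasure) -
      (A x + ε * A 0) + ((A x - η x) + ε * A 0) =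
        (∫ s, B₁ (x, s) * (A (x - s) + ε * A s) ∂jostMeasure) - η x := by ring
    rw [h5] at h4
    have h6 : C * (2 * (Real.exp (L * x) / L) + 2 * R * b) + (R + R) =
        2 * C * (3 + 2 * C * b) / L * Real.exp (L * x) := by
      rw [hR]
      ring
    have h7 := mul_le_mul_of_nonneg_right hCL (Real.exp_pos (L * x)).le
    linarith

end IsUnitKernel

/-! ### The completeness properties -/

theorem MemL1m.integrableOn {S : Set ℝ} {q : ℝ → ℝ} (h : MemL1m 1 S q) : IntegrableOn q S := by
  have h1 : IntegrableOn (fun x => (1 + |x|)⁻¹ * ((1 + |x|) ^ 1 * q x)) S := by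
    refine Integrable.bdd_mul (c := 1) h (Measurable.aestronglyMeasurable (by fun_prop))
      (Eventually.of_forall fun x => ?_)
    have := abs_nonneg x
    rw [norm_inv, Real.norm_eq_abs, abs_of_pos (by linarith)]
    exact inv_le_one_of_one_le₀ (by linarith)
  refine h1.congr (Eventually.of_forall fun x => ?_)
  have : 1 + |x| ≠ 0 := by have := abs_nonneg x; linarith
  simp only [pow_one]
  field_simp

theorem measurePreserving_neg_restrict {s : Set ℝ} (hs : MeasurableSet s) :
    MeasurePreserving (fun x : ℝ => -x) (volume.restrict (Neg.neg ⁻¹' s)) (volume.restrict s) :=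
  (Measure.measurePreserving_neg (volume : Measure ℝ)).restrict_preimage hs

theorem MemL1m.comp_neg {q : ℝ → ℝ} (h : MemL1m 1 (Iio 0) q) :
    MemL1m 1 (Ioi 0) fun x => q (-x) := by
  have hneg := measurePreserving_neg_restrict (measurableSet_Iio (a := (0 : ℝ)))
  have h1 := hneg.integrable_comp_of_integrable h
  simpa [Function.comp_def, MemL1m, IntegrableOn] using h1

/-- A measurable representative of the potential, extended by zero to the left. -/
theorem MemL1m.exists_measurable {q : ℝ → ℝ} (h : MemL1m 1 (Ioi 0) q) :
    ∃ Q : ℝ → ℝ, Measurable Q ∧ Integrable Q ∧ Integrable (fun t => max t 0 * Q t) ∧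
      (∀ t, t ≤ 0 → Q t = 0) ∧ Q =ᵐ[volume.restrict (Ici 0)] q := by
  have hqi := h.integrableOn
  set r := hqi.1.mk q with hr
  have hrm : Measurable r := hqi.1.stronglyMeasurable_mk.measurable
  have hrq : q =ᵐ[volume.restrict (Ioi 0)] r := hqi.1.ae_eq_mk
  refine ⟨(Ioi 0).indicator r, hrm.indicator measurableSet_Ioi, ?_, ?_, fun t ht =>
    indicator_of_notMem (show t ∉ Ioi 0 from not_lt.2 ht) _, ?_⟩
  · rw [integrable_indicator_iff measurableSet_Ioi]
    exact hqi.congr hrq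
  · have h1 : IntegrableOn (fun t => max t 0 * r t) (Ioi 0) := by
      refine Integrable.mono' (g := fun t => |(1 + |t|) ^ 1 * q t|) h.abs
        (Measurable.aestronglyMeasurable (by fun_prop)) ?_
      filter_upwards [hrq, ae_restrict_mem measurableSet_Ioi] with t ht htpos
      have : 0 < t := htpos
      rw [← ht, norm_mul, abs_mul, Real.norm_eq_abs, Real.norm_eq_abs, max_eq_left this.le,
        pow_one, abs_of_pos this, abs_of_pos (by linarith : 0 < 1 + t)]
      exact mul_le_mul_of_nonneg_right (by linarith) (abs_nonneg _)
    refine ((integrable_indicator_iff measurableSet_Ioi).2 h1).congr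
      (Eventually.of_forall fun t => ?_)
    by_cases ht : t ∈ Ioi (0 : ℝ) <;> simp [ht]
  · rw [← restrict_Ioi_eq_restrict_Ici]
    filter_upwards [hrq, ae_restrict_mem measurableSet_Ioi] with t ht htpos
    rw [indicator_of_mem htpos, ht]

theorem IsJostMajorant.isUnitKernel {q M : ℝ → ℝ} (h : IsJostMajorant q M) (hq : Measurable q)
    (hi : Integrable q) :
    IsUnitKernel (Ici 0) (jostKernel q) (max (2 * (∫ t, |q t|) * M 0) (2 * M 0)) := by
  have h0 : 0 ≤ ∫ t, |q t| := integral_nonneg fun _ => abs_nonneg _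
  have hM := h.pos 0
  refine ⟨measurable_jostKernel hq, le_max_of_le_right (by linarith),
    fun x _ => h.jostKernel_zero hq hi x, fun x hx s hs => ?_, fun x hx => ?_⟩
  · refine le_max_of_le_left ((h.abs_jostKernel_le hq hi hs).trans ?_)
    exact mul_le_mul_of_nonneg_left (h.anti hx) (by linarith)
  · refine (h.lintegral_jostKernel_le hq x).trans (ENNReal.ofReal_le_ofReal ?_)
    have := h.anti (show (0 : ℝ) ≤ x from hx)
    exact le_max_of_le_right (by linarith)

theorem exists_isUnitKernel {q₁ q₂ : ℝ → ℝ} (hq₁ : Measurable q₁) (hi₁ : Integrable q₁)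
    (hm₁ : Integrable fun t => max t 0 * q₁ t) (hq₂ : Measurable q₂) (hi₂ : Integrable q₂)
    (hm₂ : Integrable fun t => max t 0 * q₂ t) :
    ∃ C, IsUnitKernel (Ici 0) (jostKernel q₁) C ∧ IsUnitKernel (Ici 0) (jostKernel q₂) C := by
  obtain ⟨M₁, h₁⟩ := exists_isJostMajorant hq₁ hi₁ hm₁
  obtain ⟨M₂, h₂⟩ := exists_isJostMajorant hq₂ hi₂ hm₂
  exact ⟨_, (h₁.isUnitKernel hq₁ hi₁).mono (le_max_left _ _),
    (h₂.isUnitKernel hq₂ hi₂).mono (le_max_right _ _)⟩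

theorem IsUnitKernel.mono_set {S T : Set ℝ} {B : ℝ × ℝ → ℝ} {C : ℝ} (h : IsUnitKernel S B C)
    (hT : T ⊆ S) : IsUnitKernel T B C :=
  ⟨h.meas, h.nonneg, fun x hx => h.zero x (hT hx), fun x hx => h.bound x (hT hx),
    fun x hx => h.mass x (hT hx)⟩

/-- Completeness of the products of Jost solutions, for measurable potentials and a general `p`. -/
theorem ae_eq_zero_of_integral_jostFun {q₁ q₂ p : ℝ → ℝ} (hq₁ : Measurable q₁)
    (hi₁ : Integrable q₁) (hm₁ : Integrable fun t => max t 0 * q₁ t) (hq₂ : Measurable q₂)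
    (hi₂ : Integrable q₂) (hm₂ : Integrable fun t => max t 0 * q₂ t) (hp : IntegrableOn p (Ioi 0))
    (h : ∀ k : ℝ, 0 < k →
      ∫ x in Ioi (0 : ℝ), (p x : ℂ) * jostFun q₁ k x * jostFun q₂ k x = 0) :
    p =ᵐ[volume.restrict (Ioi 0)] 0 := by
  obtain ⟨C, h₁, h₂⟩ := exists_isUnitKernel hq₁ hi₁ hm₁ hq₂ hi₂ hm₂
  have hae := hp.1.ae_eq_mk
  refine hae.trans (IsUnitKernel.ae_eq_zero_of_integral_jost (h₁.mono_set Ioi_subset_Ici_self)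
    (h₂.mono_set Ioi_subset_Ici_self) (hp.congr hae) hp.1.stronglyMeasurable_mk.measurable ?_)
  intro k hk
  rw [← h k hk]
  refine integral_congr_ae ?_
  filter_upwards [hae] with x hx
  rw [← hx, jostFun, jostFun, show (k * ((2 * x : ℝ) : ℂ) * Complex.I) =
    k * x * Complex.I + k * x * Complex.I by push_cast; ring, Complex.exp_add]
  ring

theorem jostTransform_neg (B : ℝ × ℝ → ℝ) (k x : ℝ) :
    jostTransform B (-k) x = (starRingEnd ℂ) (jostTransform B k x) := by
  rw [jostTransform, jostTransform, ← integral_conj]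
  refine integral_congr_ae (Eventually.of_forall fun s => ?_)
  simp only [map_mul, Complex.conj_ofReal, ← Complex.exp_conj, Complex.conj_I, map_ofNat]
  congr 2
  push_cast
  ring

theorem jostFun_neg (q : ℝ → ℝ) (k x : ℝ) :
    jostFun q (-k) x = (starRingEnd ℂ) (jostFun q k x) := by
  rw [jostFun, jostFun, map_mul, jostTransform_neg, ← Complex.exp_conj]
  simp only [map_mul, Complex.conj_ofReal, Complex.conj_I]
  congr 2
  push_cast
  ring

theorem propertyCPlus_of_memL1m {q₁ q₂ : ℝ → ℝ} (h₁ : MemL1m 1 (Ioi 0) q₁)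
    (h₂ : MemL1m 1 (Ioi 0) q₂) : PropertyCPlus q₁ q₂ := by
  intro p hp h
  obtain ⟨Q₁, hQ₁, hi₁, hm₁, -, hae₁⟩ := h₁.exists_measurable
  obtain ⟨Q₂, hQ₂, hi₂, hm₂, -, hae₂⟩ := h₂.exists_measurable
  have hsol : ∀ {q Q : ℝ → ℝ}, Measurable Q → Integrable Q → Integrable (fun t => max t 0 * Q t) →
      Q =ᵐ[volume.restrict (Ici 0)] q → ∀ k : ℝ, 0 < k → IsJostSolution q k (jostFun Q k) := by
    intro q Q hQ hi hm hae k hk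
    obtain ⟨M, hM⟩ := exists_isJostMajorant hQ hi hm
    obtain ⟨f', hf', -⟩ := hM.exists_isSchrodingerSolution hQ hi hk.ne'
    refine ⟨⟨f', (hf'.mono (subset_univ _)).congr_potential ordConnected_Ici measurableSet_Ici
      hae⟩, ?_⟩
    refine (hM.tendsto_jostFun_sub_exp hQ hi hk.ne').congr fun x => ?_
    congr 2
    ring
  exact ae_eq_zero_of_integral_jostFun hQ₁ hi₁ hm₁ hQ₂ hi₂ hm₂ hp.integrableOn fun k hk =>
    h k hk _ _ (hsol hQ₁ hi₁ hm₁ hae₁ k hk) (hsol hQ₂ hi₂ hm₂ hae₂ k hk)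

/-- The solution with prescribed behaviour at `-∞` is the reflection of a Jost solution of the
reflected potential, at the opposite frequency. -/
theorem propertyCMinus_of_memL1m {q₁ q₂ : ℝ → ℝ} (h₁ : MemL1m 1 (Iio 0) q₁)
    (h₂ : MemL1m 1 (Iio 0) q₂) : PropertyCMinus q₁ q₂ := by
  intro p hp h
  obtain ⟨Q₁, hQ₁, hi₁, hm₁, -, hae₁⟩ := h₁.comp_neg.exists_measurable
  obtain ⟨Q₂, hQ₂, hi₂, hm₂, -, hae₂⟩ := h₂.comp_neg.exists_measurable
  have hneg : MeasurePreserving (fun x : ℝ => -x) (volume.restrict (Iic 0))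
      (volume.restrict (Ici 0)) := by
    simpa using measurePreserving_neg_restrict (measurableSet_Ici (a := (0 : ℝ)))
  have hsol : ∀ {q Q : ℝ → ℝ}, Measurable Q → Integrable Q → Integrable (fun t => max t 0 * Q t) →
      Q =ᵐ[volume.restrict (Ici 0)] (fun x => q (-x)) → ∀ k : ℝ, 0 < k →
      IsLeftJostSolution q k (fun x => jostFun Q (-k) (-x)) := by
    intro q Q hQ hi hm hae k hk
    obtain ⟨M, hM⟩ := exists_isJostMajorant hQ hi hm
    have hk' : -k ≠ 0 := neg_ne_zero.2 hk.ne'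
    obtain ⟨f', hf', -⟩ := hM.exists_isSchrodingerSolution hQ hi hk'
    have hr := (hf'.neg_frequency.reflect 0).mono (subset_univ (Iic 0))
    simp only [zero_sub] at hr
    refine ⟨⟨_, hr.congr_potential ordConnected_Iic measurableSet_Iic ?_⟩, ?_⟩
    · filter_upwards [hneg.quasiMeasurePreserving.ae hae] with x hx
      rw [hx, neg_neg]
    · refine ((hM.tendsto_jostFun_sub_exp hQ hi hk').comp tendsto_neg_atBot_atTop).congr fun x => ?_
      simp only [Function.comp_apply]
      congr 2
      push_cast
      ring
  have hzero : (fun x => p (-x)) =ᵐ[volume.restrict (Ioi 0)] 0 := by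
    refine ae_eq_zero_of_integral_jostFun hQ₁ hi₁ hm₁ hQ₂ hi₂ hm₂ hp.comp_neg.integrableOn
      fun k hk => ?_
    have h0 := h k hk _ _ (hsol hQ₁ hi₁ hm₁ hae₁ k hk) (hsol hQ₂ hi₂ hm₂ hae₂ k hk)
    rw [← integral_Iic_eq_integral_Iio] at h0
    have h3 := integral_comp_neg_Ioi (0 : ℝ)
      (fun x => (p x : ℂ) * jostFun Q₁ (-k) (-x) * jostFun Q₂ (-k) (-x))
    rw [neg_zero, h0] at h3
    simp only [neg_neg] at h3
    apply (starRingEnd ℂ).injective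
    rw [map_zero, ← h3, ← integral_conj]
    refine integral_congr_ae (Eventually.of_forall fun x => ?_)
    simp only [map_mul, Complex.conj_ofReal, jostFun_neg]
  have hneg' : MeasurePreserving (fun x : ℝ => -x) (volume.restrict (Iio 0))
      (volume.restrict (Ioi 0)) := by
    simpa using measurePreserving_neg_restrict (measurableSet_Ioi (a := (0 : ℝ)))
  filter_upwards [hneg'.quasiMeasurePreserving.ae hzero] with x hx
  simpa using hx

/-- The solutions with Cauchy data at `0`, in terms of the Jost solution of the potential reflected
at `b`; that potential vanishes beyond `b`, where the Jost solution is an exponential. -/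
theorem exists_isSchrodingerSolution_regularWave {q Q : ℝ → ℝ} (hQ : Measurable Q)
    (hi : Integrable Q) (hQ0 : ∀ t, t ≤ 0 → Q t = 0) (hae : Q =ᵐ[volume.restrict (Ici 0)] q)
    {b : ℝ} (hb : 0 < b) :
    ∃ C, IsUnitKernel (Ioo 0 b) (fun y => jostKernel (fun t => Q (b - t)) (b - y.1, y.2)) C ∧
      (∀ x ∈ Ioo 0 b, ∀ s, x < s → jostKernel (fun t => Q (b - t)) (b - x, s) = 0) ∧
      ∀ k : ℝ, k ≠ 0 → ∃ u', IsSchrodingerSolution q k (Ici 0)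
        (regularWave (fun y => jostKernel (fun t => Q (b - t)) (b - y.1, y.2)) k) u' ∧
        regularWave (fun y => jostKernel (fun t => Q (b - t)) (b - y.1, y.2)) k 0 = 1 ∧
        u' 0 = k * Complex.I := by
  set P : ℝ → ℝ := fun t => Q (b - t) with hP
  have hPm : Measurable P := hQ.comp (measurable_const.sub measurable_id)
  have hPi : Integrable P := hi.comp_sub_left b
  have hP0 : ∀ t, b < t → P t = 0 := fun t ht => hQ0 _ (by linarith)
  have hPm' : Integrable fun t => max t 0 * P t := by
    refine (hPi.abs.const_mul b).mono' (Measurable.aestronglyMeasurable (by fun_prop))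
      (Eventually.of_forall fun t => ?_)
    rcases lt_or_ge b t with ht | ht
    · simp [hP0 t ht]
    · rw [norm_mul, Real.norm_eq_abs, Real.norm_eq_abs, abs_of_nonneg (le_max_right t 0)]
      exact mul_le_mul_of_nonneg_right (max_le ht hb.le) (abs_nonneg _)
  obtain ⟨M, hM⟩ := exists_isJostMajorant hPm hPi hPm'
  refine ⟨_, (hM.isUnitKernel hPm hPi).comp_sub_left b, fun x hx s hs =>
    jostKernel_eq_zero_of_lt hP0 (hx.1.trans hs) (by linarith), fun k hk => ?_⟩
  have hk' : -k ≠ 0 := neg_ne_zero.2 hk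
  obtain ⟨f', hf', hf'b⟩ := hM.exists_isSchrodingerSolution hPm hPi hk'
  have hE : Complex.exp (k * b * Complex.I) * Complex.exp ((-k : ℝ) * b * Complex.I) = 1 := by
    rw [← Complex.exp_add, ← Complex.exp_zero]
    congr 1
    push_cast
    ring
  have hwave : ∀ x : ℝ, regularWave (fun y => jostKernel P (b - y.1, y.2)) k x =
      Complex.exp (k * b * Complex.I) * jostFun P (-k) (b - x) := by
    intro x
    have hT : jostTransform (fun y => jostKernel P (b - y.1, y.2)) (-k) x =
        jostTransform (jostKernel P) (-k) (b - x) := rfl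
    rw [regularWave, jostFun, ← mul_assoc, ← Complex.exp_add, hT]
    congr 2
    push_cast
    ring
  have hr := (hf'.neg_frequency.reflect b).mono (subset_univ (Ici 0))
  have hr2 := (hr.linear hr (Complex.exp (k * b * Complex.I)) 0).congr_potential (q' := q)
    ordConnected_Ici measurableSet_Ici (by simpa only [hP, sub_sub_cancel] using hae)
  simp only [zero_mul, add_zero, ← hwave] at hr2
  refine ⟨_, hr2, ?_, ?_⟩
  · rw [hwave, sub_zero, hM.jostFun_of_eq_zero hPm hPi hk' hP0, hE]
  · simp only [sub_zero, hf'b b hP0]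
    push_cast at hE ⊢
    linear_combination (k * Complex.I) * hE

/-- Products of the solutions with Cauchy data at `0`, expanded in regular waves. -/
theorem propertyCPhi_and_propertyCPsi_of_memL1m {q₁ q₂ : ℝ → ℝ} (h₁ : MemL1m 1 (Ioi 0) q₁)
    (h₂ : MemL1m 1 (Ioi 0) q₂) : PropertyCPhi q₁ q₂ ∧ PropertyCPsi q₁ q₂ := by
  obtain ⟨Q₁, hQ₁, hi₁, -, hz₁, hae₁⟩ := h₁.exists_measurable
  obtain ⟨Q₂, hQ₂, hi₂, -, hz₂, hae₂⟩ := h₂.exists_measurable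
  have hphi : ∀ {q : ℝ → ℝ} {E : ℝ → ℝ → ℂ}, (∀ k : ℝ, k ≠ 0 → ∃ u', IsSchrodingerSolution q k
      (Ici 0) (E k) u' ∧ E k 0 = 1 ∧ u' 0 = k * Complex.I) → ∀ k : ℝ, 0 < k →
      IsPhiSolution q k (fun x => 1 / (2 * k * Complex.I) * E k x +
        -(1 / (2 * k * Complex.I)) * E (-k) x) := by
    intro q E hE k hk
    obtain ⟨u', hu, hu0, hu1⟩ := hE k hk.ne'
    obtain ⟨v', hv, hv0, hv1⟩ := hE (-k) (neg_ne_zero.2 hk.ne')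
    have hkc : (k : ℂ) ≠ 0 := by exact_mod_cast hk.ne'
    refine ⟨_, hu.linear hv.neg_frequency _ _, ?_, ?_⟩
    · simp only [hu0, hv0]
      ring
    · simp only [hu1, hv1]
      push_cast
      have := Complex.I_ne_zero
      field_simp
      norm_num
  have hpsi : ∀ {q : ℝ → ℝ} {E : ℝ → ℝ → ℂ}, (∀ k : ℝ, k ≠ 0 → ∃ u', IsSchrodingerSolution q k
      (Ici 0) (E k) u' ∧ E k 0 = 1 ∧ u' 0 = k * Complex.I) → ∀ k : ℝ, 0 < k →
      IsPsiSolution q k (fun x => 1 / 2 * E k x + 1 / 2 * E (-k) x) := by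
    intro q E hE k hk
    obtain ⟨u', hu, hu0, hu1⟩ := hE k hk.ne'
    obtain ⟨v', hv, hv0, hv1⟩ := hE (-k) (neg_ne_zero.2 hk.ne')
    refine ⟨_, hu.linear hv.neg_frequency _ _, ?_, ?_⟩
    · simp only [hu0, hv0]
      norm_num
    · simp only [hu1, hv1]
      push_cast
      ring
  refine ⟨fun b hb p hp h => ?_, fun b hb p hp h => ?_⟩
  all_goals
    obtain ⟨C₁, hC₁, hs₁, hE₁⟩ := exists_isSchrodingerSolution_regularWave hQ₁ hi₁ hz₁ hae₁ hb
    obtain ⟨C₂, hC₂, hs₂, hE₂⟩ := exists_isSchrodingerSolution_regularWave hQ₂ hi₂ hz₂ hae₂ hb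
    have hae := hp.1.ae_eq_mk
  · refine hae.trans (IsUnitKernel.ae_eq_zero_of_integral_regular (ε := -1) hb (by simp)
      (hC₁.mono (le_max_left C₁ C₂)) (hC₂.mono (le_max_right C₁ C₂)) hs₁ hs₂ (hp.congr hae)
      hp.1.stronglyMeasurable_mk.measurable fun k hk => ?_)
    have hkc : (k : ℂ) ≠ 0 := by exact_mod_cast hk.ne'
    have h0 := h k hk _ _ (hphi hE₁ k hk) (hphi hE₂ k hk)
    have h4 := congrArg (fun z : ℂ => -4 * (k : ℂ) ^ 2 * z) h0
    simp only [mul_zero, ← integral_const_mul] at h4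
    refine Eq.trans (integral_congr_ae ?_) h4
    filter_upwards [hae] with x hx
    rw [← hx]
    have := Complex.I_ne_zero
    field_simp
    rw [Complex.I_sq]
    push_cast
    ring
  · refine hae.trans (IsUnitKernel.ae_eq_zero_of_integral_regular (ε := 1) hb (by simp)
      (hC₁.mono (le_max_left C₁ C₂)) (hC₂.mono (le_max_right C₁ C₂)) hs₁ hs₂ (hp.congr hae)
      hp.1.stronglyMeasurable_mk.measurable fun k hk => ?_)
    have h0 := h k hk _ _ (hpsi hE₁ k hk) (hpsi hE₂ k hk)
    have h4 := congrArg (fun z : ℂ => 4 * z) h0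
    simp only [mul_zero, ← integral_const_mul] at h4
    refine Eq.trans (integral_congr_ae ?_) h4
    filter_upwards [hae] with x hx
    rw [← hx]
    push_cast
    ring

theorem theorem1p1 :
    (∀ q₁ q₂ : ℝ → ℝ, MemL1m 1 (Ioi 0) q₁ → MemL1m 1 (Ioi 0) q₂ →
      PropertyCPlus q₁ q₂ ∧ PropertyCPhi q₁ q₂ ∧ PropertyCPsi q₁ q₂) ∧
    (∀ q₁ q₂ : ℝ → ℝ, MemL1m 1 (Iio 0) q₁ → MemL1m 1 (Iio 0) q₂ →
      PropertyCMinus q₁ q₂) :=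
  ⟨fun _ _ h₁ h₂ => ⟨propertyCPlus_of_memL1m h₁ h₂, propertyCPhi_and_propertyCPsi_of_memL1m h₁ h₂⟩,
    fun _ _ h₁ h₂ => propertyCMinus_of_memL1m h₁ h₂⟩
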